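/- **Setting.** A function $f:\mathbb N\to\mathbb R_{\ge 0}$ is *negligible* if for every real polynomial $p$ that is positive on $\mathbb N$ there is $N$ with $f(\lambda)<1/p(\lambda)$ for all $\lambda>N$. A *PPT algorithm* is a (uniform) algorithm whose input includes $1^\lambda$ and a tape of uniformly random bits of length $q(\lambda)$, $q$ a polynomial, and whose running time is bounded by a polynomial in $\lambda$. Let $L:\mathbb N\to\mathbb N$ be given by a polynomial, with $L(\lambda)>\lambda$ for all $\lambda$. Let $\mathrm{RandGen}$ be an *asymptotically secure pseudo-random generator*: a deterministic polynomial-time algorithm mapping $s\in\{0,1\}^\lambda$ to $\mathrm{RandGen}(s)\in\{0,1\}^{160L(\lambda)}$ such that for every PPT distinguisher $\mathcal D$ the function $\lambda\mapsto|\Pr[\mathcal D(\mathrm{RandGen}(s))=1]-\Pr[\mathcal D(r)=1]|$ is negligible, where $s\in\{0,1\}^\lambda$ and $r\in\{0,1\}^{160L(\lambda)}$ are uniform. **Scheme $\Pi$.** Signals are sequences of 16-bit signed samples. A speech signal $x$ has $160L$ samples at 8 kHz ($L$ frames of 20 ms, samples outside the signal being $0$), and $y=\mathrm{Enc}_r(x)$,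 for $r\in\{0,1\}^{160L}$, has $320L$ samples at 16 kHz. The following data, independent of $\lambda$, are arbitrary but fixed: a taper of length 320, nine nonnegative spectral windows, the shape assigned to a frame of zero energy (a nonnegative unit vector of $\mathbb R^9$), a pitch tracker with finite memory, which at each frame maps its memory and the current window to its new memory and a frequency estimate $f_0>0$, bounds $0<p_{min}<p_{max}$, $0<\varepsilon_{min}<\varepsilon_{max}$, $0<\kappa_{low}<\kappa_{high}<2^{16}-1$, $0<\varrho_{low}<\varrho_{high}<2^{16}-1$, $0<\tilde p_{min}<\tilde p_{max}$, $0<\tilde\varepsilon_{min}<\tilde\varepsilon_{max}$, the number $K_{(\omega_0)}$ of harmonics as a function of $\omega_0$, and a real $16\times240$ matrix $\mathrm H$ of spectral windows. Frame $\ell=0,\dots,L-1$ is processed as follows. *Encoding.* The signal is filtered by $1-0.85z^{-1}$; on the 40 ms window consisting of the frame and the 10 ms before and after it, the power spectrum of the tapered window is weighted by the nine spectral windows, giving $E_1,\dots,E_9$, $\varepsilon=\sum_iE_i$ and $\mathbf D=(\sqrt{E_i/\varepsilon})_i\in S^8$; the tracker gives $p=8000/f_0$. Then $p$ and $\varepsilon$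 are thresholded to $[p_{min},p_{max}]$ and $[\varepsilon_{min},\varepsilon_{max}]$. *Enciphering.* The $\ell$-th block of 160 bits of $r$ is cut into consecutive chunks of lengths $16,16,15,16,16,16,16,16,16,17$, read as unsigned integers $\nu_1,\dots,\nu_{10}$. The values $p$ and $\log_{10}\varepsilon$ are linearly scaled to $[\kappa_{low},\kappa_{high}]$ and $[\varrho_{low},\varrho_{high}]$ and rounded to $\kappa,\varrho\in\mathbb Z_{2^{16}}$; $\kappa_{enc}=\kappa+\nu_1$, $\varrho_{enc}=\varrho+\nu_2$ in $\mathbb Z_{2^{16}}$; these are scaled linearly from $[0,2^{16}-1]$ to $\tilde p\in[\tilde p_{min},\tilde p_{max}]$ and $\log_{10}\tilde\varepsilon\in[\log_{10}\tilde\varepsilon_{min},\log_{10}\tilde\varepsilon_{max}]$. With $\xi=1/\sqrt8$, $\gamma(\mathbf D)=\xi\cdot(\text{spherical coordinates of }\mathbf D)\in\mathbb R^8$, $\Lambda_\alpha=\frac{2\pi}{2^{16}\sqrt8}\Gamma_8$ ($\Gamma_8$ the Gosset lattice) and $\Lambda_\beta=\frac{2\pi}{\sqrt8}\mathbb Z^8$,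 let $\chi$ be a vector of $\Lambda_\alpha$ closest to $2\gamma(\mathbf D)$, let $\chi_{enc}=\chi+\nu_3\alpha_1+\dots+\nu_{10}\alpha_8$ modulo $\Lambda_\beta$, where $\alpha_1=c\cdot2e_1$, $\alpha_j=c(e_j-e_{j-1})$ for $2\le j\le7$, $\alpha_8=\frac c2(1,\dots,1)$, $c=\frac{2\pi}{2^{16}\sqrt8}$, and let $\tilde{\mathbf D}=\big(\xi\cos(\chi_{enc,i}/\xi),\,\xi\sin(\chi_{enc,i}/\xi)\big)_{i\le8}\in S^{15}$. *Synthesis.* With $\omega_0=2\pi f_s/\tilde p$, $f_s=16000$, let $\mathrm B$ be the $240\times K_{(\omega_0)}$ matrix whose $k$-th column is the DFT of $(e^{jk\omega_0n/f_s})_{0\le n<240}$ (here $j=\sqrt{-1}$), let $\breve{\mathbf A}=(\mathrm{HB})^\dagger\big(\tilde D_k\,e^{2\pi jk/16}\big)_{k\le16}$ (Moore–Penrose inverse), and let $\mathbf y[n]=\eta\sum_k|\breve A_k|\cos(k\omega_0n/f_s+\mathrm{Arg}\,\breve A_k-80k\omega_0/f_s)$, $0\le n<400$, with $\eta\ge0$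 such that $\sum_{n=80}^{319}\mathbf y[n]^2=\tilde\varepsilon$ ($\eta=0$ if the unscaled waveform vanishes at these samples). The frames are multiplied by the trapezoidal window with ramps of 80 samples, added with hop 320, cut to $320L$ samples, and rounded to 16-bit samples with saturation. **Experiment $\mathrm{PrivK}^{eav}_{\mathcal A,\Pi}(\lambda)$.** The PPT adversary $\mathcal A$, given $1^\lambda$, chooses two distinct speech signals $x_0,x_1$ of $160L(\lambda)$ samples; a uniform seed $s\in\{0,1\}^\lambda$ and a uniform bit $b$ are drawn; $\mathcal A$ receives $\mathrm{Enc}_{\mathrm{RandGen}(s)}(x_b)$ and outputs a bit $b'$; the result is $1$ iff $b'=b$. **Proposition.** $\Pi$ has indistinguishable encryptions in the presence of an eavesdropper: for every PPT adversary $\mathcal A$ there is a negligible function $\mathbf{negl}$ such that for all $\lambda$ $$\left|\Pr\big(\mathrm{PrivK}^{eav}_{\mathcal A,\Pi}(\lambda)=1\big)-\tfrac12\right|\le\mathbf{negl}(\lambda).$$ Moreover, one negligible function $\mathbf{negl}$ serves all adversaries: for every PPT adversary $\mathcal A$ the same bound holds for all sufficiently large $\lambda$ (depending on $\mathcal A$).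 -/

import Mathlib

namespace SpeechEnc

/-! ### Computational model: structured programs over stacks of bits -/

/-- A memory: registers indexed by `ℕ`, each of them a stack of bits. -/
abbrev Store := ℕ → List Bool

/-- Structured programs over stacks of bits (a multi-stack machine). Every instruction inspects or
changes a single bit on top of a single stack, so that the number of executed instructions agrees
with the running time of a multi-tape Turing machine up to a polynomial. -/
inductive Prog : Type
  /-- do nothing -/
  | skip : Prog
  /-- put the bit `b` on top of register `x` -/
  | push (x : ℕ) (b : Bool) : Prog
  /-- remove the top bit of register `x`, if there is one -/
  | pop (x : ℕ) : Prog
  /-- sequential composition -/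
  | seq (p q : Prog) : Prog
  /-- branch on register `x`: empty, top bit `0`, or top bit `1` -/
  | cond (x : ℕ) (pEmpty pFalse pTrue : Prog) : Prog
  /-- repeat `p` as long as register `x` is nonempty -/
  | loop (x : ℕ) (p : Prog) : Prog

/-- `Run p s s' t`: started in the memory `s`, the program `p` halts in the memory `s'` after `t`
instructions. -/
inductive Prog.Run : Prog → Store → Store → ℕ → Prop
  | skip (s : Store) : Prog.Run Prog.skip s s 1
  | push (x : ℕ) (b : Bool) (s : Store) :
      Prog.Run (Prog.push x b) s (Function.update s x (b :: s x)) 1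
  | pop (x : ℕ) (s : Store) :
      Prog.Run (Prog.pop x) s (Function.update s x (s x).tail) 1
  | seq {p q : Prog} {s s' s'' : Store} {t t' : ℕ} :
      Prog.Run p s s' t → Prog.Run q s' s'' t' → Prog.Run (Prog.seq p q) s s'' (t + t')
  | condEmpty {x : ℕ} {pe pf pt : Prog} {s s' : Store} {t : ℕ} :
      s x = [] → Prog.Run pe s s' t → Prog.Run (Prog.cond x pe pf pt) s s' (t + 1)
  | condFalse {x : ℕ} {pe pf pt : Prog} {s s' : Store} {t : ℕ} {l : List Bool} :
      s x = false :: l → Prog.Run pf s s' t → Prog.Run (Prog.cond x pe pf pt) s s' (t + 1)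
  | condTrue {x : ℕ} {pe pf pt : Prog} {s s' : Store} {t : ℕ} {l : List Bool} :
      s x = true :: l → Prog.Run pt s s' t → Prog.Run (Prog.cond x pe pf pt) s s' (t + 1)
  | loopDone {x : ℕ} {p : Prog} {s : Store} :
      s x = [] → Prog.Run (Prog.loop x p) s s 1
  | loopStep {x : ℕ} {p : Prog} {s s' s'' : Store} {t t' : ℕ} :
      s x ≠ [] → Prog.Run p s s' t → Prog.Run (Prog.loop x p) s' s'' t' →
        Prog.Run (Prog.loop x p) s s'' (t + t' + 1)

/-- The initial memory: the inputs stand in registers `0, 1, 2, …`, all others are empty. -/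
def load (inputs : List (List Bool)) : Store := fun i => inputs.getD i []

/-- On the given inputs, `p` halts within `T` instructions, with the given outputs in registers
`0, 1, 2, …`. -/
def Prog.Outputs (p : Prog) (inputs outputs : List (List Bool)) (T : ℕ) : Prop :=
  ∃ (s : Store) (t : ℕ), Prog.Run p (load inputs) s t ∧ t ≤ T ∧
    ∀ i : Fin outputs.length, s i = outputs.get i

/-- The string `1ⁿ`. -/
def unary (n : ℕ) : List Bool := List.replicate n true

/-! ### Probability, negligible functions, pseudo-random generators -/

/-- Probability of the event `E` under the uniform distribution on a finite set. -/
noncomputable def uniformPr {Ω : Type} [Fintype Ω] (E : Ω → Bool) : ℝ :=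
  ((Finset.univ.filter (fun ω => E ω = true)).card : ℝ) / (Fintype.card Ω : ℝ)

/-- Negligible functions: nonnegative and eventually below `1 / p` for every positive
polynomial `p`. -/
def Negligible (f : ℕ → ℝ) : Prop :=
  (∀ n, 0 ≤ f n) ∧
    ∀ p : Polynomial ℝ, (∀ n : ℕ, 0 < p.eval (n : ℝ)) →
      ∃ N : ℕ, ∀ n : ℕ, N < n → f n < 1 / p.eval (n : ℝ)

/-- Bit strings of length `k`. -/
abbrev Bits (k : ℕ) : Type := Fin k → Bool

/-- A probabilistic polynomial-time distinguisher for bit strings of length `160 L(n)`. Randomness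
is a uniform tape of `coins n` bits; the algorithm sees `1ⁿ`, the string and its tape. -/
structure Distinguisher (L : ℕ → ℕ) where
  /-- number of random bits -/
  coins : Polynomial ℕ
  /-- the decision -/
  decide : (n : ℕ) → Bits (160 * L n) → Bits (coins.eval n) → Bool
  /-- the decision is computed by a program in polynomial time -/
  polyTime : ∃ (p : Prog) (T : Polynomial ℕ),
    ∀ (n : ℕ) (r : Bits (160 * L n)) (ρ : Bits (coins.eval n)),
      p.Outputs [unary n, List.ofFn r, List.ofFn ρ] [[decide n r ρ]] (T.eval n)

/-- Distinguishing advantage of `D` against the generator `G` run on a uniform seed. -/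
noncomputable def prgAdvantage {L : ℕ → ℕ} (G : (n : ℕ) → Bits n → Bits (160 * L n))
    (D : Distinguisher L) (n : ℕ) : ℝ :=
  |uniformPr (fun ω : Bits n × Bits (D.coins.eval n) => D.decide n (G n ω.1) ω.2) -
    uniformPr (fun ω : Bits (160 * L n) × Bits (D.coins.eval n) => D.decide n ω.1 ω.2)|

/-- `G` is an asymptotically secure pseudo-random generator: it is computed in polynomial time, and
every probabilistic polynomial-time distinguisher has negligible advantage. -/
def IsSecurePRG {L : ℕ → ℕ} (G : (n : ℕ) → Bits n → Bits (160 * L n)) : Prop :=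
  (∃ (p : Prog) (T : Polynomial ℕ), ∀ (n : ℕ) (s : Bits n),
      p.Outputs [List.ofFn s] [List.ofFn (G n s)] (T.eval n)) ∧
    ∀ D : Distinguisher L, Negligible (prgAdvantage G D)

/-! ### Signals -/

/-- A sampled signal of `N` samples, in 16-bit signed (two's complement) representation. -/
abbrev Signal (N : ℕ) : Type := Fin N → BitVec 16

/-- The bit string of a signal, 16 bits per sample. -/
def signalBits {N : ℕ} (x : Signal N) : List Bool :=
  (List.ofFn x).flatMap (fun v => List.ofFn (fun i : Fin 16 => v.getLsbD i))

/-- The sample at time `t`, zero outside the duration of the signal. -/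
noncomputable def sampleAt {N : ℕ} (x : Signal N) (t : ℤ) : ℝ :=
  if h : 0 ≤ t ∧ t < N then ((x ⟨t.toNat, by omega⟩).toInt : ℝ) else 0

/-- Rounding to the nearest integer, saturated at the bounds of the 16-bit format. -/
noncomputable def quantize (y : ℝ) : BitVec 16 :=
  BitVec.ofInt 16 (max (-2 ^ 15) (min (2 ^ 15 - 1) (round y)))

/-! ### Parameters that an implementation of the scheme has to fix -/

/-- The data left open by the description of the scheme. None of them depends on the security
parameter. -/
structure Codec where
  /-- taper of the 40 ms analysis window -/
  taper : Fin 320 → ℝ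
  /-- the nine spectral windows of the speech encoder, on the 161 bins of the power spectrum -/
  melWindow : Fin 9 → Fin 161 → ℝ
  melWindow_nonneg : ∀ i k, 0 ≤ melWindow i k
  /-- the envelope shape assigned to a frame without energy -/
  silentShape : Fin 9 → ℝ
  silentShape_nonneg : ∀ i, 0 ≤ silentShape i
  silentShape_norm : ∑ i, silentShape i ^ 2 = 1
  /-- the pitch tracker has a finite memory with `trackerSize + 1` states -/
  trackerSize : ℕ
  /-- from the memory and the current window: the new memory and the estimated fundamental
  frequency in Hz -/
  tracker : Fin (trackerSize + 1) → (Fin 320 → ℝ) → Fin (trackerSize + 1) × ℝ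
  tracker_pos : ∀ q w, 0 < (tracker q w).2
  /-- pitch period bounds of speech -/
  pMin : ℝ
  pMax : ℝ
  pMin_pos : 0 < pMin
  pMin_lt : pMin < pMax
  /-- energy bounds of speech -/
  eMin : ℝ
  eMax : ℝ
  eMin_pos : 0 < eMin
  eMin_lt : eMin < eMax
  /-- guard bounds of pitch -/
  kLow : ℝ
  kHigh : ℝ
  kLow_pos : 0 < kLow
  kLow_lt : kLow < kHigh
  kHigh_lt : kHigh < 2 ^ 16 - 1
  /-- guard bounds of energy -/
  rLow : ℝ
  rHigh : ℝ
  rLow_pos : 0 < rLow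
  rLow_lt : rLow < rHigh
  rHigh_lt : rHigh < 2 ^ 16 - 1
  /-- pitch period bounds of pseudo-speech -/
  pMin' : ℝ
  pMax' : ℝ
  pMin'_pos : 0 < pMin'
  pMin'_lt : pMin' < pMax'
  /-- energy bounds of pseudo-speech -/
  eMin' : ℝ
  eMax' : ℝ
  eMin'_pos : 0 < eMin'
  eMin'_lt : eMin' < eMax'
  /-- number of harmonics as a function of the fundamental frequency `ω₀` -/
  harmonics : ℝ → ℕ
  /-- the sixteen spectral windows of the synthesizer, sampled on the 240 bins of the DFT -/
  squareWindow : Matrix (Fin 16) (Fin 240) ℝ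

/-! ### Speech encoding -/

/-- Pre-emphasis by the filter `1 - 0.85 z⁻¹`. -/
noncomputable def emphasized {N : ℕ} (x : Signal N) (t : ℤ) : ℝ :=
  sampleAt x t - 0.85 * sampleAt x (t - 1)

/-- The 40 ms window of frame `l` (at 8 kHz): the 20 ms frame of 160 samples, with 10 ms before
it and 10 ms of look-ahead. -/
noncomputable def window {N : ℕ} (x : Signal N) (l : ℕ) : Fin 320 → ℝ :=
  fun i => emphasized x (160 * (l : ℤ) - 80 + (i : ℕ))

/-- Power spectrum of a window. -/
noncomputable def psd (C : Codec) (w : Fin 320 → ℝ) (k : Fin 161) : ℝ :=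
  ‖∑ i : Fin 320, ((C.taper i * w i : ℝ) : ℂ) *
    Complex.exp (-(2 * Real.pi * (k : ℕ) * (i : ℕ) / 320) * Complex.I)‖ ^ 2

/-- The nine band energies. -/
noncomputable def bandEnergy (C : Codec) (w : Fin 320 → ℝ) (i : Fin 9) : ℝ :=
  ∑ k : Fin 161, C.melWindow i k * psd C w k

/-- The frame energy, before thresholding. -/
noncomputable def frameEnergy (C : Codec) (w : Fin 320 → ℝ) : ℝ :=
  ∑ i : Fin 9, bandEnergy C w i

open Classical in
/-- The shape of the spectral envelope, a vector on the nonnegative part of the 8-sphere. -/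
noncomputable def envelope (C : Codec) (w : Fin 320 → ℝ) : Fin 9 → ℝ :=
  if frameEnergy C w = 0 then C.silentShape
  else fun i => Real.sqrt (bandEnergy C w i / frameEnergy C w)

/-- Memory of the pitch tracker before frame `l`. -/
noncomputable def trackerState (C : Codec) {N : ℕ} (x : Signal N) : ℕ → Fin (C.trackerSize + 1)
  | 0 => 0
  | l + 1 => (C.tracker (trackerState C x l) (window x l)).1

/-- Thresholding to the interval `[a, b]`. -/
noncomputable def clamp (a b v : ℝ) : ℝ := max a (min b v)

/-- The pitch period (in samples at 8 kHz) of frame `l`, thresholded. -/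
noncomputable def pitchPeriod (C : Codec) {N : ℕ} (x : Signal N) (l : ℕ) : ℝ :=
  clamp C.pMin C.pMax (8000 / (C.tracker (trackerState C x l) (window x l)).2)

/-- The energy of frame `l`, thresholded. -/
noncomputable def energy (C : Codec) {N : ℕ} (x : Signal N) (l : ℕ) : ℝ :=
  clamp C.eMin C.eMax (frameEnergy C (window x l))

/-! ### Flat torus and lattices -/

/-- Points of `ℝ⁸`. -/
abbrev E8 : Type := EuclideanSpace ℝ (Fin 8)

/-- The common coordinate `1 / √8` of the vector `ξ`. -/
noncomputable def xi : ℝ := 1 / Real.sqrt 8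

/-- Spherical coordinates of a vector of `ℝ⁹`: for `i < 7` the angle in `[0, π]` between the `i`-th
axis and the vector of the remaining coordinates `i, …, 8`; the last one is the polar angle in
`[0, 2π)` of the last two coordinates. -/
noncomputable def sphericalAngle (x : Fin 9 → ℝ) (i : Fin 8) : ℝ :=
  if (i : ℕ) < 7 then
    Complex.arg ⟨x i.castSucc,
      Real.sqrt (∑ j ∈ Finset.univ.filter (fun j : Fin 9 => i.castSucc < j), x j ^ 2)⟩
  else toIcoMod Real.two_pi_pos 0 (Complex.arg ⟨x 7, x 8⟩)

/-- The mapping `γ_ξ` from the 8-sphere to `ℝ⁸`. -/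
noncomputable def gammaMap (x : Fin 9 → ℝ) : E8 :=
  WithLp.toLp 2 (fun i => xi * sphericalAngle x i)

/-- The torus mapping `Φ_ξ : ℝ⁸ → S¹⁵`, `u ↦ (ξ cos (uᵢ/ξ), ξ sin (uᵢ/ξ))ᵢ`. -/
noncomputable def torusMap (u : E8) : Fin 16 → ℝ := fun k =>
  let i : Fin 8 := ⟨(k : ℕ) / 2, by omega⟩
  if (k : ℕ) % 2 = 0 then xi * Real.cos (u i / xi) else xi * Real.sin (u i / xi)

/-- The Gosset lattice `Γ₈`: all coordinates integers or all of them half-integers, with an even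
sum. -/
def gosset : Set E8 :=
  {v | ((∀ i, ∃ m : ℤ, v i = m) ∨ (∀ i, ∃ m : ℤ, v i = m + 1 / 2)) ∧ ∃ m : ℤ, ∑ i, v i = 2 * m}

/-- The scale `2π / (2¹⁶ √8)`. -/
noncomputable def latticeScale : ℝ := 2 * Real.pi / (2 ^ 16 * Real.sqrt 8)

/-- The scaled Gosset lattice `Λ_α`. -/
def latticeA : Set E8 := {v | ∃ u ∈ gosset, v = latticeScale • u}

/-- The basis of `Λ_α` used for scrambling, as multiples of the scale: `2e₁`,
`e₂ - e₁, …, e₇ - e₆`, and `(1/2, …, 1/2)`. -/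
noncomputable def alphaBasis (j : Fin 8) : E8 :=
  latticeScale • WithLp.toLp 2 (fun i : Fin 8 =>
    if (j : ℕ) = 0 then (if (i : ℕ) = 0 then (2 : ℝ) else 0)
    else if (j : ℕ) = 7 then 1 / 2
    else if i = j then 1
    else if (i : ℕ) + 1 = (j : ℕ) then -1
    else 0)

/-- Reduction modulo `Λ_β = (2π/√8) ℤ⁸`, to the representative in `[0, 2π/√8)⁸`. -/
noncomputable def reduceB (u : E8) : E8 :=
  WithLp.toLp 2 (fun i => toIcoMod
    (show (0 : ℝ) < 2 * Real.pi * xi by unfold xi; positivity) 0 (u i))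

theorem latticeScale_pos : 0 < latticeScale := by
  unfold latticeScale; positivity

theorem latticeA_half {v : E8} (hv : v ∈ latticeA) (i : Fin 8) :
    ∃ m : ℤ, v i = latticeScale * (m / 2) := by
  obtain ⟨u, ⟨hu, -⟩, rfl⟩ := hv
  rcases hu with hu | hu
  · obtain ⟨m, hm⟩ := hu i
    exact ⟨2 * m, by simp [hm]⟩
  · obtain ⟨m, hm⟩ := hu i
    refine ⟨2 * m + 1, ?_⟩
    simp only [PiLp.smul_apply, smul_eq_mul, hm]
    push_cast
    ring

theorem latticeA_closed : IsClosed latticeA := by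
  have hs := latticeScale_pos
  refine Metric.isClosed_of_pairwise_le_dist (ε := latticeScale / 2) (by positivity) ?_
  intro v hv w hw hne
  have : ∃ i, v i ≠ w i := by
    by_contra h
    push Not at h
    exact hne (by ext i; exact h i)
  obtain ⟨i, hi⟩ := this
  obtain ⟨a, ha⟩ := latticeA_half hv i
  obtain ⟨b, hb⟩ := latticeA_half hw i
  have hab : a - b ≠ 0 := by
    intro h
    apply hi
    rw [ha, hb, sub_eq_zero.mp h]
  have h1 : (1 : ℝ) ≤ |((a - b : ℤ) : ℝ)| := by
    exact_mod_cast Int.one_le_abs hab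
  have h2 : |v i - w i| ≤ dist v w := by
    rw [dist_eq_norm]
    simpa using PiLp.norm_apply_le (v - w) i
  refine le_trans ?_ h2
  have h3 : v i - w i = latticeScale / 2 * ((a - b : ℤ) : ℝ) := by
    rw [ha, hb]; push_cast; ring
  rw [h3, abs_mul, abs_of_pos (by positivity : 0 < latticeScale / 2)]
  nlinarith

/-- The closest vector problem in `Λ_α` has a solution. -/
theorem exists_closest (u : E8) : ∃ v ∈ latticeA, ∀ w ∈ latticeA, dist u v ≤ dist u w := by
  have h0 : (latticeA).Nonempty :=
    ⟨0, 0, ⟨Or.inl fun i => ⟨0, by simp⟩, 0, by simp⟩, by simp⟩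
  obtain ⟨v, hv, h⟩ := latticeA_closed.exists_infDist_eq_dist h0 u
  exact ⟨v, hv, fun w hw => h ▸ Metric.infDist_le_dist_of_mem hw⟩

/-- A closest vector of `Λ_α` (ties are broken arbitrarily). -/
noncomputable def closestVector (u : E8) : E8 := Classical.choose (exists_closest u)

/-! ### Enciphering of the parameters of a frame -/

/-- Bit `t` of the key stream. -/
def keyBit {L : ℕ} (r : Bits (160 * L)) (t : ℕ) : Bool :=
  if h : t < 160 * L then r ⟨t, h⟩ else false

/-- The bit lengths of the ten random integers of a frame, 160 bits in total. -/
def chunkLength : Fin 10 → ℕ := ![16, 16, 15, 16, 16, 16, 16, 16, 16, 17]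

/-- The `j`-th random integer of frame `l`: consecutive chunks of the key stream, read as unsigned
integers (most significant bit first). -/
def mask {L : ℕ} (r : Bits (160 * L)) (l : ℕ) (j : Fin 10) : ℕ :=
  ∑ i ∈ Finset.range (chunkLength j),
    if keyBit r (160 * l + ∑ j' ∈ Finset.univ.filter (· < j), chunkLength j' + i)
    then 2 ^ (chunkLength j - 1 - i) else 0

/-- The affine map that takes `[a, b]` to `[c, d]`. -/
noncomputable def rescale (a b c d v : ℝ) : ℝ := c + (v - a) / (b - a) * (d - c)

/-- The quantized pitch period of frame `l`. -/
noncomputable def pitchInit (C : Codec) {N : ℕ} (x : Signal N) (l : ℕ) : ZMod (2 ^ 16) :=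
  ((round (rescale C.pMin C.pMax C.kLow C.kHigh (pitchPeriod C x l)) : ℤ) : ZMod (2 ^ 16))

/-- The quantized energy of frame `l`, in logarithmic scale. -/
noncomputable def energyInit (C : Codec) {N : ℕ} (x : Signal N) (l : ℕ) : ZMod (2 ^ 16) :=
  ((round (rescale (Real.logb 10 C.eMin) (Real.logb 10 C.eMax) C.rLow C.rHigh
    (Real.logb 10 (energy C x l))) : ℤ) : ZMod (2 ^ 16))

/-- The quantized envelope shape of frame `l`. -/
noncomputable def shapeInit (C : Codec) {N : ℕ} (x : Signal N) (l : ℕ) : E8 :=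
  closestVector ((2 : ℝ) • gammaMap (envelope C (window x l)))

/-- The enciphered pitch period of frame `l`. -/
noncomputable def pitchEnc (C : Codec) {L : ℕ} (r : Bits (160 * L)) (x : Signal (160 * L))
    (l : ℕ) : ZMod (2 ^ 16) :=
  pitchInit C x l + (mask r l 0 : ZMod (2 ^ 16))

/-- The enciphered energy of frame `l`. -/
noncomputable def energyEnc (C : Codec) {L : ℕ} (r : Bits (160 * L)) (x : Signal (160 * L))
    (l : ℕ) : ZMod (2 ^ 16) :=
  energyInit C x l + (mask r l 1 : ZMod (2 ^ 16))

/-- The enciphered envelope shape of frame `l`: translation in `Λ_α` modulo `Λ_β`. -/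
noncomputable def shapeEnc (C : Codec) {L : ℕ} (r : Bits (160 * L)) (x : Signal (160 * L))
    (l : ℕ) : E8 :=
  reduceB (shapeInit C x l + ∑ j : Fin 8, (mask r l (j.natAdd 2) : ℝ) • alphaBasis j)

/-- Pseudo-speech pitch period. -/
noncomputable def pseudoPitch (C : Codec) (k : ZMod (2 ^ 16)) : ℝ :=
  rescale 0 (2 ^ 16 - 1) C.pMin' C.pMax' (k.val : ℝ)

/-- Pseudo-speech energy, by linear scaling in the logarithmic domain. -/
noncomputable def pseudoEnergy (C : Codec) (k : ZMod (2 ^ 16)) : ℝ :=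
  (10 : ℝ) ^ rescale 0 (2 ^ 16 - 1) (Real.logb 10 C.eMin') (Real.logb 10 C.eMax') (k.val : ℝ)

/-! ### Pseudo-speech synthesis -/

/-- The Moore–Penrose inverse `(MᴴM)⁺ Mᴴ`, where the positive semidefinite matrix `MᴴM` is
inverted on its nonzero eigenvalues (note `0⁻¹ = 0`). -/
noncomputable def pinv {m n : ℕ} (M : Matrix (Fin m) (Fin n) ℂ) : Matrix (Fin n) (Fin m) ℂ :=
  let h := Matrix.isHermitian_conjTranspose_mul_self M
  let U : Matrix (Fin n) (Fin n) ℂ := h.eigenvectorUnitary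
  U * Matrix.diagonal (fun i => (((h.eigenvalues i)⁻¹ : ℝ) : ℂ)) * U.conjTranspose * M.conjTranspose

/-- Column `k` is the DFT of the 240 samples of the `(k+1)`-st harmonic `exp (j (k+1) ω₀/f_s · n)`,
with `f_s = 16000`. -/
noncomputable def harmonicDFT (w0 : ℝ) (K : ℕ) : Matrix (Fin 240) (Fin K) ℂ := fun m k =>
  ∑ n : Fin 240, Complex.exp ((((k : ℕ) + 1) * w0 / 16000 * (n : ℕ) : ℝ) * Complex.I) *
    Complex.exp (-(2 * Real.pi * (m : ℕ) * (n : ℕ) / 240) * Complex.I)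

/-- The complex amplitudes of the harmonics: least-squares solution of
`D ⊙ W₁₆ = H B A`. -/
noncomputable def amplitudes (C : Codec) (w0 : ℝ) (D : Fin 16 → ℝ) :
    Fin (C.harmonics w0) → ℂ :=
  (pinv (C.squareWindow.map (fun a => (a : ℂ)) * harmonicDFT w0 (C.harmonics w0))).mulVec
    (fun k => (D k : ℂ) * Complex.exp (2 * Real.pi * ((k : ℕ) + 1) / 16 * Complex.I))

/-- The harmonic waveform of a frame, before energy scaling. -/
noncomputable def waveform (C : Codec) (w0 : ℝ) (D : Fin 16 → ℝ) (n : ℕ) : ℝ :=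
  ∑ k : Fin (C.harmonics w0), ‖amplitudes C w0 D k‖ *
    Real.cos (((k : ℕ) + 1) * w0 / 16000 * n +
      (Complex.arg (amplitudes C w0 D k) - ((k : ℕ) + 1) * w0 / 16000 * 80))

/-- The frame with pitch period `p`, energy `e` (measured on the samples `80, …, 319`) and envelope
shape `D`. -/
noncomputable def synthFrame (C : Codec) (p e : ℝ) (D : Fin 16 → ℝ) (n : ℕ) : ℝ :=
  let w0 := 2 * Real.pi * 16000 / p
  Real.sqrt (e / ∑ m ∈ Finset.Icc 80 319, waveform C w0 D m ^ 2) * waveform C w0 D n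

/-- The trapezoidal window of 25 ms (400 samples at 16 kHz), with two ramps of 5 ms. -/
noncomputable def trapezoid (n : ℕ) : ℝ :=
  if n < 80 then n / 80 else if n < 320 then 1 else if n < 400 then (400 - n) / 80 else 0

/-! ### The encryption algorithm and the indistinguishability experiment -/

/-- Encryption of a speech signal of `L` frames (20 ms each, sampled at 8 kHz) with the key stream
`r`: windowed frames overlap by 5 ms and are added up; the result has the same duration and is
sampled at 16 kHz. -/
noncomputable def encrypt (C : Codec) {L : ℕ} (r : Bits (160 * L)) (x : Signal (160 * L)) :
    Signal (320 * L) := fun t =>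
  quantize (∑ l ∈ Finset.range L,
    if 320 * l ≤ (t : ℕ) then
      trapezoid (t - 320 * l) *
        synthFrame C (pseudoPitch C (pitchEnc C r x l)) (pseudoEnergy C (energyEnc C r x l))
          (torusMap (shapeEnc C r x l)) (t - 320 * l)
    else 0)

/-- A probabilistic polynomial-time adversary, given by its next-message functions. Randomness is a
uniform tape of `coins n` bits, which the adversary keeps. From `1ⁿ` and the tape it chooses two
distinct signals; from `1ⁿ`, the tape and the challenge ciphertext it outputs a bit. -/
structure Adversary (L : ℕ → ℕ) where
  /-- number of random bits -/
  coins : Polynomial ℕ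
  /-- the pair of signals -/
  choose : (n : ℕ) → Bits (coins.eval n) → Signal (160 * L n) × Signal (160 * L n)
  /-- the final guess -/
  guess : (n : ℕ) → Bits (coins.eval n) → Signal (320 * L n) → Bool
  choose_ne : ∀ n ρ, (choose n ρ).1 ≠ (choose n ρ).2
  /-- both functions are computed by programs in polynomial time -/
  choose_polyTime : ∃ (p : Prog) (T : Polynomial ℕ), ∀ (n : ℕ) (ρ : Bits (coins.eval n)),
    p.Outputs [unary n, List.ofFn ρ]
      [signalBits (choose n ρ).1, signalBits (choose n ρ).2] (T.eval n)
  guess_polyTime : ∃ (p : Prog) (T : Polynomial ℕ),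
    ∀ (n : ℕ) (ρ : Bits (coins.eval n)) (y : Signal (320 * L n)),
      p.Outputs [unary n, List.ofFn ρ, signalBits y] [[guess n ρ y]] (T.eval n)

/-- One run of the experiment, with seed `s`, challenge bit `b` and random tape `ρ`; the result is
`true` iff the adversary guesses `b`. -/
noncomputable def privKEav (C : Codec) {L : ℕ → ℕ} (G : (n : ℕ) → Bits n → Bits (160 * L n))
    (A : Adversary L) (n : ℕ) (s : Bits n) (b : Bool) (ρ : Bits (A.coins.eval n)) : Bool :=
  let x := if b then (A.choose n ρ).2 else (A.choose n ρ).1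
  A.guess n ρ (encrypt C (G n s) x) == b

/-- Probability that the experiment outputs 1, for a uniform seed, challenge bit and tape. -/
noncomputable def privKEavPr (C : Codec) {L : ℕ → ℕ} (G : (n : ℕ) → Bits n → Bits (160 * L n))
    (A : Adversary L) (n : ℕ) : ℝ :=
  uniformPr (fun ω : Bits n × Bool × Bits (A.coins.eval n) =>
    privKEav C G A n ω.1 ω.2.1 ω.2.2)

end SpeechEnc

namespace SpeechEnc

/-! ### Programs: determinism, countability, renaming of registers -/

/-! The scheme is a one-time pad in disguise. Per frame, the synthesizer sees only an element of the
finite group `Param`, the product of the ℤ/2^k with k running over the chunk lengths. The quantized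
pitch, energy and lattice point give an element of this group, the key block gives another, and the
frame depends on their sum (`encFrame_eq`). The chunk lengths add up to 160, and key blocks
correspond bijectively to group elements (`maskParam_bijective`). A uniform key therefore hides the
signal perfectly (`exists_key_equiv`), and every adversary then wins with probability exactly 1/2
(`uniformPr_win`).

With a pseudo-random key, the adversary becomes a distinguisher: use the given string as the key,
the first coin as challenge bit, and accept if the adversary wins. Its advantage equals the
adversary's deviation from 1/2 (`exists_distinguisher`), so the latter is negligible.

The reduction must run in polynomial time although the codec is made of arbitrary real functions.
Samples have 16 bits, the tracker has finite memory, and each frame interacts only with its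
neighbours, so encryption is a finite-state transducer with state space independent of the security
parameter. Its transition table is written into the program text, and the program runs in linear
time (`exists_encrypt_prog`).

For the common negligible function, there are only countably many adversaries, since each is
determined by its coin polynomial and two programs. A diagonal argument dominates countably many
negligible functions eventually by one (`exists_negligible_bound`).

Determinism, proved here, is what makes a program determine the function it computes. -/

theorem Prog.Run.det {p : Prog} {s s₁ : Store} {t₁ : ℕ} (h₁ : Prog.Run p s s₁ t₁) :
    ∀ {s₂ : Store} {t₂ : ℕ}, Prog.Run p s s₂ t₂ → s₁ = s₂ := by
  induction h₁ with
  | skip s => intro s₂ t₂ h; cases h; rfl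
  | push x b s => intro s₂ t₂ h; cases h; rfl
  | pop x s => intro s₂ t₂ h; cases h; rfl
  | seq _ _ ih₁ ih₂ =>
    intro s₂ t₂ h
    cases h with
    | seq ha hb => cases ih₁ ha; exact ih₂ hb
  | condEmpty hx _ ih => intro s₂ t₂ h; cases h <;> simp_all; exact ih ‹_›
  | condFalse hx _ ih => intro s₂ t₂ h; cases h <;> simp_all; exact ih ‹_›
  | condTrue hx _ ih => intro s₂ t₂ h; cases h <;> simp_all; exact ih ‹_›
  | loopDone hx => intro s₂ t₂ h; cases h with
    | loopDone => rfl
    | loopStep hne => exact absurd hx hne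
  | loopStep hx _ _ ih₁ ih₂ =>
    intro s₂ t₂ h
    cases h with
    | loopDone he => exact absurd he hx
    | loopStep _ ha hb => cases ih₁ ha; exact ih₂ hb

/-- A numbering of programs. -/
def Prog.code : Prog → ℕ
  | .skip => Nat.pair 0 0
  | .push x b => Nat.pair 1 (Nat.pair x b.toNat)
  | .pop x => Nat.pair 2 x
  | .seq p q => Nat.pair 3 (Nat.pair p.code q.code)
  | .cond x p q r => Nat.pair 4 (Nat.pair x (Nat.pair p.code (Nat.pair q.code r.code)))
  | .loop x p => Nat.pair 5 (Nat.pair x p.code)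

theorem Prog.code_injective : Function.Injective Prog.code := by
  intro p
  induction p with
  | skip => intro q h; cases q <;> simp_all [Prog.code]
  | push x b =>
    intro q h
    cases q with
    | push y c => cases b <;> cases c <;> simp_all [Prog.code]
    | _ => simp [Prog.code] at h
  | pop x => intro q h; cases q <;> simp_all [Prog.code]
  | seq p₁ p₂ ih₁ ih₂ =>
    intro q h
    cases q with
    | seq =>
      simp only [Prog.code, Nat.pair_eq_pair, true_and] at h
      rw [ih₁ h.1, ih₂ h.2]
    | _ => simp [Prog.code] at h
  | cond x p₁ p₂ p₃ ih₁ ih₂ ih₃ =>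
    intro q h
    cases q with
    | cond =>
      simp only [Prog.code, Nat.pair_eq_pair, true_and] at h
      rw [h.1, ih₁ h.2.1, ih₂ h.2.2.1, ih₃ h.2.2.2]
    | _ => simp [Prog.code] at h
  | loop x p ih =>
    intro q h
    cases q with
    | loop =>
      simp only [Prog.code, Nat.pair_eq_pair, true_and] at h
      rw [h.1, ih h.2]
    | _ => simp [Prog.code] at h

instance : Countable Prog := Prog.code_injective.countable

/-- The program `p` with register `x` replaced by `f x`. -/
def Prog.rename (f : ℕ → ℕ) : Prog → Prog
  | .skip => .skip
  | .push x b => .push (f x) b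
  | .pop x => .pop (f x)
  | .seq p q => .seq (p.rename f) (q.rename f)
  | .cond x p q r => .cond (f x) (p.rename f) (q.rename f) (r.rename f)
  | .loop x p => .loop (f x) (p.rename f)

theorem update_comp_eq {f : ℕ → ℕ} (hf : Function.Injective f) {S s : Store}
    (hS : ∀ i, S (f i) = s i) (x : ℕ) (l : List Bool) (i : ℕ) :
    Function.update S (f x) l (f i) = Function.update s x l i := by
  by_cases h : i = x
  · subst h; simp
  · rw [Function.update_of_ne (fun e => h (hf e)), Function.update_of_ne h, hS]

/-- Lets a foreign program run as a subroutine on its own registers: its course depends only on the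
registers in the range of `f`, and all others survive. -/
theorem Prog.Run.rename {f : ℕ → ℕ} (hf : Function.Injective f) {p : Prog} {s s' : Store} {t : ℕ}
    (h : Prog.Run p s s' t) : ∀ {S : Store}, (∀ i, S (f i) = s i) →
      ∃ S' : Store, Prog.Run (p.rename f) S S' t ∧ (∀ i, S' (f i) = s' i) ∧
        ∀ i, i ∉ Set.range f → S' i = S i := by
  induction h with
  | skip s => intro S hS; exact ⟨S, .skip S, hS, fun _ _ => rfl⟩
  | push x b s =>
    intro S hS
    refine ⟨_, .push (f x) b S, fun i => ?_, fun i hi => ?_⟩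
    · rw [hS x]; exact update_comp_eq hf hS _ _ _
    · exact Function.update_of_ne (fun e => hi ⟨x, e.symm⟩) _ _
  | pop x s =>
    intro S hS
    refine ⟨_, .pop (f x) S, fun i => ?_, fun i hi => ?_⟩
    · rw [hS x]; exact update_comp_eq hf hS _ _ _
    · exact Function.update_of_ne (fun e => hi ⟨x, e.symm⟩) _ _
  | seq _ _ ih₁ ih₂ =>
    intro S hS
    obtain ⟨S₁, r₁, h₁, k₁⟩ := ih₁ hS
    obtain ⟨S₂, r₂, h₂, k₂⟩ := ih₂ h₁
    exact ⟨S₂, .seq r₁ r₂, h₂, fun i hi => (k₂ i hi).trans (k₁ i hi)⟩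
  | condEmpty hx _ ih =>
    intro S hS
    obtain ⟨S₁, r₁, h₁, k₁⟩ := ih hS
    exact ⟨S₁, .condEmpty ((hS _).trans hx) r₁, h₁, k₁⟩
  | condFalse hx _ ih =>
    intro S hS
    obtain ⟨S₁, r₁, h₁, k₁⟩ := ih hS
    exact ⟨S₁, .condFalse ((hS _).trans hx) r₁, h₁, k₁⟩
  | condTrue hx _ ih =>
    intro S hS
    obtain ⟨S₁, r₁, h₁, k₁⟩ := ih hS
    exact ⟨S₁, .condTrue ((hS _).trans hx) r₁, h₁, k₁⟩
  | loopDone hx => intro S hS; exact ⟨S, .loopDone ((hS _).trans hx), hS, fun _ _ => rfl⟩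
  | loopStep hx _ _ ih₁ ih₂ =>
    intro S hS
    obtain ⟨S₁, r₁, h₁, k₁⟩ := ih₁ hS
    obtain ⟨S₂, r₂, h₂, k₂⟩ := ih₂ h₁
    exact ⟨S₂, .loopStep (fun e => hx ((hS _).symm.trans e)) r₁ r₂, h₂,
      fun i hi => (k₂ i hi).trans (k₁ i hi)⟩

/-! ### Programs with time bounds -/

/-- Started in `s`, the program `p` halts in `s'` within `T` instructions. -/
def Prog.Does (p : Prog) (s s' : Store) (T : ℕ) : Prop := ∃ t ≤ T, Prog.Run p s s' t

namespace Prog.Does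

variable {p q : Prog} {s s' s'' : Store} {T T' : ℕ}

theorem mono (h : p.Does s s' T) (hT : T ≤ T') : p.Does s s' T' := by
  obtain ⟨t, ht, hr⟩ := h
  exact ⟨t, ht.trans hT, hr⟩

theorem seq (h₁ : p.Does s s' T) (h₂ : q.Does s' s'' T') : (Prog.seq p q).Does s s'' (T + T') := by
  obtain ⟨t, ht, hr⟩ := h₁
  obtain ⟨t', ht', hr'⟩ := h₂
  exact ⟨t + t', by omega, .seq hr hr'⟩

theorem push (x : ℕ) (b : Bool) (s : Store) :
    (Prog.push x b).Does s (Function.update s x (b :: s x)) 1 := ⟨1, le_rfl, .push x b s⟩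

theorem pop (x : ℕ) (s : Store) :
    (Prog.pop x).Does s (Function.update s x (s x).tail) 1 := ⟨1, le_rfl, .pop x s⟩

theorem condEmpty {x : ℕ} {pe pf pt : Prog} (hx : s x = []) (h : pe.Does s s' T) :
    (Prog.cond x pe pf pt).Does s s' (T + 1) := by
  obtain ⟨t, ht, hr⟩ := h
  exact ⟨t + 1, by omega, .condEmpty hx hr⟩

theorem condCons {x : ℕ} {pe pf pt : Prog} {b : Bool} {l : List Bool} (hx : s x = b :: l)
    (h : (bif b then pt else pf).Does s s' T) :
    (Prog.cond x pe pf pt).Does s s' (T + 1) := by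
  obtain ⟨t, ht, hr⟩ := h
  cases b
  · exact ⟨t + 1, by omega, .condFalse hx hr⟩
  · exact ⟨t + 1, by omega, .condTrue hx hr⟩

/-- The trajectory `σ` is given in advance, so a loop is verified one round at a time; the extra
instruction per round is the test of `x`. -/
theorem loop {x : ℕ} (n : ℕ) (σ : ℕ → Store) (hne : ∀ i < n, σ i x ≠ []) (hn : σ n x = [])
    (h : ∀ i < n, p.Does (σ i) (σ (i + 1)) T) :
    (Prog.loop x p).Does (σ 0) (σ n) ((T + 1) * n + 1) := by
  induction n generalizing σ with
  | zero => exact ⟨1, by simp, .loopDone hn⟩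
  | succ n ih =>
    obtain ⟨t, ht, hr⟩ := h 0 (by omega)
    obtain ⟨t', ht', hr'⟩ := ih (fun i => σ (i + 1)) (fun i hi => hne _ (by omega)) hn
      (fun i hi => h _ (by omega))
    refine ⟨t + t' + 1, ?_, .loopStep (hne 0 (by omega)) hr hr'⟩
    rw [Nat.mul_succ]; omega

end Prog.Does

/-- Push the bits of a list, the first one first. -/
def pushList (x : ℕ) : List Bool → Prog
  | [] => .skip
  | b :: l => .seq (.push x b) (pushList x l)

theorem pushList_does (x : ℕ) (l : List Bool) (s : Store) :
    (pushList x l).Does s (Function.update s x (l.reverse ++ s x)) (l.length + 1) := by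
  induction l generalizing s with
  | nil => exact ⟨1, by simp, by simpa [pushList] using Prog.Run.skip s⟩
  | cons b l ih =>
    have h := (Prog.Does.push x b s).seq (ih _)
    simp only [Function.update_self, Function.update_idem] at h
    simp only [List.reverse_cons, List.append_assoc, List.singleton_append, List.length_cons]
    exact h.mono (by omega)

/-- The first `k` bits of a list, continued by zeros. -/
def padTake : ℕ → List Bool → List Bool
  | 0, _ => []
  | k + 1, l => l.headD false :: padTake k l.tail

theorem padTake_eq_ofFn (k : ℕ) (l : List Bool) :
    padTake k l = List.ofFn (fun i : Fin k => l.getD i false) := by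
  induction k generalizing l with
  | zero => simp [padTake]
  | succ k ih =>
    rw [padTake, ih, List.ofFn_succ]
    cases l <;> simp

theorem padTake_of_length {k : ℕ} {l : List Bool} (h : l.length = k) : padTake k l = l := by
  subst h
  rw [padTake_eq_ofFn]
  apply List.ext_getElem <;> simp

/-- Remove `k` bits from register `x` and continue according to their values; missing bits count
as zeros. -/
def readBits (x : ℕ) : ℕ → (List Bool → Prog) → Prog
  | 0, cont => cont []
  | k + 1, cont => .cond x (readBits x k fun l => cont (false :: l))
      (.seq (.pop x) (readBits x k fun l => cont (false :: l)))
      (.seq (.pop x) (readBits x k fun l => cont (true :: l)))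

/-- The program is a decision tree of depth `k` with one leaf `cont l` per bit string. Any function
of `k` bits, computable or not, is thereby tabulated in the program text; the table enlarges the
program, while the time grows only by a test and a pop per bit. -/
theorem readBits_does (x k : ℕ) (cont : List Bool → Prog) (s s' : Store) (T : ℕ)
    (h : (cont (padTake k (s x))).Does (Function.update s x ((s x).drop k)) s' T) :
    (readBits x k cont).Does s s' (T + 2 * k) := by
  induction k generalizing cont s with
  | zero => simpa [padTake, readBits] using h
  | succ k ih =>
    rw [readBits]
    rcases hx : s x with _ | ⟨b, l⟩
    · refine ((ih (fun l => cont (false :: l)) s ?_).condEmpty hx).mono (by omega)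
      simpa [hx, padTake] using h
    · have := ih (fun l => cont (b :: l)) (Function.update s x (s x).tail)
        (by simpa [hx, padTake] using h)
      have := (Prog.Does.pop x s).seq this
      refine (Prog.Does.condCons hx (T := 1 + (T + 2 * k)) ?_).mono (by omega)
      cases b <;> exact this

/-- Move the content of register `x` to the registers `y` and `z`, in reverse order. -/
def pour (x : ℕ) (y z : ℕ) : Prog :=
  .loop x (readBits x 1 fun l => .seq (pushList y l) (pushList z l))

theorem pour_does {x y z : ℕ} (hy : y ≠ x) (hz : z ≠ x) (hyz : y ≠ z) (s : Store) :
    (pour x y z).Does s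
      (Function.update (Function.update (Function.update s x []) y ((s x).reverse ++ s y)) z
        ((s x).reverse ++ s z)) (7 * (s x).length + 1) := by
  -- One round costs 2 for reading the bit and 2 for each of the two one-bit `pushList`s.
  have key := Prog.Does.loop (p := readBits x 1 fun l => .seq (pushList y l) (pushList z l))
    (x := x) (T := 6) (s x).length
    (fun i => Function.update (Function.update (Function.update s x ((s x).drop i)) y
      (((s x).take i).reverse ++ s y)) z (((s x).take i).reverse ++ s z)) ?_ ?_ ?_
  · simpa [hy.symm, hz.symm, pour] using key
  · intro i hi
    simpa [hy.symm, hz.symm] using hi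
  · simp [hy.symm, hz.symm]
  · intro i hi
    refine (readBits_does x 1 _ _ _ 4 ?_).mono le_rfl
    obtain ⟨b, hd, ht⟩ : ∃ b, (s x).drop i = b :: (s x).drop (i + 1) ∧
        (s x).take (i + 1) = (s x).take i ++ [b] :=
      ⟨(s x)[i], List.drop_eq_getElem_cons hi, List.take_succ_eq_append_getElem hi⟩
    convert (pushList_does y [b] _).seq (pushList_does z [b] _) using 1
    · simp [hy.symm, hz.symm, hd, padTake]
    · rw [ht]
      funext r
      by_cases h1 : r = x
      · subst h1; simp [hy.symm, hz.symm, hd]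
      · by_cases h2 : r = z
        · subst h2; simp [hz, Function.update_of_ne hyz.symm]
        · by_cases h3 : r = y
          · subst h3; simp [hy, hyz]
          · simp [h1, h2, h3]
    · simp

/-! ### Enciphered frame parameters as elements of a finite group -/

theorem exists_latticeA_coords {v : E8} (hv : v ∈ latticeA) :
    ∃ a : Fin 8 → ℤ, v = ∑ j, (a j : ℝ) • alphaBasis j := by
  obtain ⟨u, ⟨hu, m, hm⟩, rfl⟩ := hv
  obtain ⟨w, d, hw, hd⟩ : ∃ (w : Fin 8 → ℤ) (d : ℤ), (∀ i, u i = w i + (d : ℝ) / 2) ∧ w 7 = 0 := by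
    rcases hu with hu | hu
    · choose z hz using hu
      exact ⟨fun i => z i - z 7, 2 * z 7, fun i => by rw [hz]; push_cast; ring, by simp⟩
    · choose z hz using hu
      exact ⟨fun i => z i - z 7, 2 * z 7 + 1, fun i => by rw [hz]; push_cast; ring, by simp⟩
  -- The last coordinate is met only by the vector (1/2, …, 1/2), which forces its coefficient `d`.
  -- The differences telescope, so their coefficients are tail sums of `w`. What remains for `2e₁`
  -- is half the sum of all `w i`, an integer because the sum of the `u i` is even.
  have hsum : ((w 0 + w 1 + w 2 + w 3 + w 4 + w 5 + w 6 : ℤ) : ℝ) = 2 * (m - 2 * d : ℤ) := by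
    simp only [hw, Fin.sum_univ_eight, hd] at hm
    push_cast at hm ⊢
    linarith
  refine ⟨![m - 2 * d, w 1 + w 2 + w 3 + w 4 + w 5 + w 6, w 2 + w 3 + w 4 + w 5 + w 6,
    w 3 + w 4 + w 5 + w 6, w 4 + w 5 + w 6, w 5 + w 6, w 6, d], ?_⟩
  push_cast at hsum
  ext i
  fin_cases i <;>
    simp [Fin.sum_univ_eight, alphaBasis, hw, hd] <;> try ring1
  linear_combination latticeScale * hsum

theorem reduceB_congr {u v : E8}
    (h : ∀ i, ∃ m : ℤ, u i = v i + m * (2 * Real.pi * xi)) : reduceB u = reduceB v := by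
  ext i
  obtain ⟨m, hm⟩ := h i
  simp only [reduceB, hm, ← zsmul_eq_mul]
  exact toIcoMod_add_zsmul _ _ _ _

/-- This is where the chunk lengths 15, 16, 17 come from: in units of the scale, `Λ_β` is 2¹⁶ℤ⁸, and
the nonzero entries of the basis vectors are 2, ±1 and 1/2 respectively. -/
theorem alphaBasis_order (j i : Fin 8) :
    ∃ m : ℤ, (2 : ℝ) ^ chunkLength (j.natAdd 2) * alphaBasis j i = m * (2 * Real.pi * xi) := by
  have hs : 2 * Real.pi * xi = 2 ^ 16 * latticeScale := by
    unfold xi latticeScale; field_simp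
  rw [hs]
  obtain ⟨m, hm⟩ : ∃ m : ℤ, (2 : ℝ) ^ chunkLength (j.natAdd 2) *
      (if (j : ℕ) = 0 then (if (i : ℕ) = 0 then (2 : ℝ) else 0)
        else if (j : ℕ) = 7 then 1 / 2
        else if i = j then 1
        else if (i : ℕ) + 1 = (j : ℕ) then -1
        else 0) = m * 2 ^ 16 := by
    have e : ∀ j : Fin 8, chunkLength (j.natAdd 2) = if (j : ℕ) = 0 then 15 else
        if (j : ℕ) = 7 then 17 else 16 := by decide
    rw [e]
    split_ifs
    · exact ⟨1, by norm_num⟩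
    · exact ⟨0, by norm_num⟩
    · exact ⟨1, by norm_num⟩
    · exact ⟨1, by norm_num⟩
    · exact ⟨-1, by norm_num⟩
    · exact ⟨0, by norm_num⟩
  refine ⟨m, ?_⟩
  simp only [alphaBasis, PiLp.smul_apply, smul_eq_mul]
  linear_combination latticeScale * hm

/-- The synthesized frame with the enciphered parameters `k`: pitch, energy, and eight coordinates
of the envelope shape. -/
noncomputable def frameOf (C : Codec) (k : Fin 10 → ℤ) : ℕ → ℝ :=
  synthFrame C (pseudoPitch C (k 0 : ZMod (2 ^ 16))) (pseudoEnergy C (k 1 : ZMod (2 ^ 16)))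
    (torusMap (reduceB (∑ j : Fin 8, (k (j.natAdd 2) : ℝ) • alphaBasis j)))

/-- Changing a coordinate by a multiple of 2 to its chunk length moves the lattice point by an
element of `Λ_β`, which `reduceB` removes. Hence the frame is a function on a finite group. -/
theorem frameOf_congr (C : Codec) {k k' : Fin 10 → ℤ}
    (h : ∀ j, (k j : ZMod (2 ^ chunkLength j)) = k' j) : frameOf C k = frameOf C k' := by
  have h0 : (k 0 : ZMod (2 ^ 16)) = k' 0 := h 0
  have h1 : (k 1 : ZMod (2 ^ 16)) = k' 1 := h 1
  have h2 : reduceB (∑ j : Fin 8, (k (j.natAdd 2) : ℝ) • alphaBasis j) =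
      reduceB (∑ j : Fin 8, (k' (j.natAdd 2) : ℝ) • alphaBasis j) := by
    refine reduceB_congr fun i => ?_
    have h3 : ∀ j : Fin 8, ∃ m : ℤ, (k (j.natAdd 2) : ℝ) * alphaBasis j i =
        k' (j.natAdd 2) * alphaBasis j i + m * (2 * Real.pi * xi) := by
      intro j
      obtain ⟨d, hd⟩ := (ZMod.intCast_eq_intCast_iff_dvd_sub _ _ _).1 (h (j.natAdd 2)).symm
      obtain ⟨m, hm⟩ := alphaBasis_order j i
      refine ⟨d * m, ?_⟩
      have hd' : (k (j.natAdd 2) : ℝ) - k' (j.natAdd 2) = 2 ^ chunkLength (j.natAdd 2) * d := by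
        exact_mod_cast hd
      push_cast
      linear_combination d * hm + alphaBasis j i * hd'
    choose m hm using h3
    refine ⟨∑ j, m j, ?_⟩
    simp only [WithLp.ofLp_sum, Finset.sum_apply, smul_eq_mul, hm,
      Finset.sum_add_distrib, WithLp.ofLp_smul, Pi.smul_apply]
    push_cast
    rw [Finset.sum_mul]
  rw [frameOf, frameOf, h0, h1, h2]

/-- The group of the enciphered parameters of a frame. -/
abbrev Param : Type := ∀ j : Fin 10, ZMod (2 ^ chunkLength j)

/-- The synthesized frame as a function of the enciphered parameters. -/
noncomputable def paramFrame (C : Codec) (k : Param) : ℕ → ℝ :=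
  frameOf C (fun j => ((k j).val : ℤ))

theorem paramFrame_intCast (C : Codec) (k : Fin 10 → ℤ) :
    paramFrame C (fun j => (k j : ZMod (2 ^ chunkLength j))) = frameOf C k :=
  frameOf_congr C fun j => by simp

/-- Integer coordinates of a vector of `Λ_α` in the basis `alphaBasis`. -/
noncomputable def latticeCoords (u : E8) : Fin 8 → ℤ :=
  Classical.choose (exists_latticeA_coords (Classical.choose_spec (exists_closest u)).1)

theorem latticeCoords_spec (u : E8) :
    closestVector u = ∑ j, (latticeCoords u j : ℝ) • alphaBasis j :=
  Classical.choose_spec (exists_latticeA_coords (Classical.choose_spec (exists_closest u)).1)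

/-- The quantized parameters of a frame as integers, from the tracker memory and the window. -/
noncomputable def plainInt (C : Codec) (q : Fin (C.trackerSize + 1)) (w : Fin 320 → ℝ) :
    Fin 10 → ℤ :=
  Fin.cons (round (rescale C.pMin C.pMax C.kLow C.kHigh
      (clamp C.pMin C.pMax (8000 / (C.tracker q w).2))))
    (Fin.cons (round (rescale (Real.logb 10 C.eMin) (Real.logb 10 C.eMax) C.rLow C.rHigh
      (Real.logb 10 (clamp C.eMin C.eMax (frameEnergy C w)))))
      (latticeCoords ((2 : ℝ) • gammaMap (envelope C w))))

/-- The quantized parameters of a frame. -/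
noncomputable def plainParam (C : Codec) (q : Fin (C.trackerSize + 1)) (w : Fin 320 → ℝ) : Param :=
  fun j => (plainInt C q w j : ZMod (2 ^ chunkLength j))

/-- The random parameters of frame `l`. -/
def maskParam {L : ℕ} (r : Bits (160 * L)) (l : ℕ) : Param :=
  fun j => (mask r l j : ZMod (2 ^ chunkLength j))

/-- The two additions in ℤ/2¹⁶ and the translation modulo `Λ_β` merge into one addition in `Param`.
-/
theorem encFrame_eq (C : Codec) {L : ℕ} (r : Bits (160 * L)) (x : Signal (160 * L)) (l : ℕ) :
    synthFrame C (pseudoPitch C (pitchEnc C r x l)) (pseudoEnergy C (energyEnc C r x l))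
      (torusMap (shapeEnc C r x l)) =
    paramFrame C (plainParam C (trackerState C x l) (window x l) + maskParam r l) := by
  have hk : plainParam C (trackerState C x l) (window x l) + maskParam r l =
      fun j => ((plainInt C (trackerState C x l) (window x l) j + mask r l j : ℤ) :
        ZMod (2 ^ chunkLength j)) := by
    funext j; simp [plainParam, maskParam]
  rw [hk, paramFrame_intCast, frameOf]
  have hj : ∀ j : Fin 8, (Fin.natAdd 2 j : Fin 10) = j.succ.succ := by decide
  have hs : shapeEnc C r x l = reduceB (∑ j : Fin 8,
      ((plainInt C (trackerState C x l) (window x l) (j.natAdd 2) + mask r l (j.natAdd 2) : ℤ) : ℝ)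
        • alphaBasis j) := by
    rw [shapeEnc, shapeInit, latticeCoords_spec, ← Finset.sum_add_distrib]
    congr 1
    refine Finset.sum_congr rfl fun j _ => ?_
    rw [← add_smul, hj]
    simp [plainInt]
  have hp : pitchEnc C r x l =
      ((plainInt C (trackerState C x l) (window x l) 0 + mask r l 0 : ℤ) : ZMod (2 ^ 16)) := by
    rw [Int.cast_add, Int.cast_natCast]
    rfl
  have he : energyEnc C r x l =
      ((plainInt C (trackerState C x l) (window x l) 1 + mask r l 1 : ℤ) : ZMod (2 ^ 16)) := by
    rw [Int.cast_add, Int.cast_natCast]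
    rfl
  rw [hs, hp, he]

/-! ### Perfect secrecy for a uniform key -/

/-- Chunks are read with the most significant bit first, whereas `Nat.ofBits` starts with the least
significant one; after the reversal single key bits are recovered by `Nat.testBit`. -/
theorem mask_eq_ofBits {L : ℕ} (r : Bits (160 * L)) (l : ℕ) (j : Fin 10) :
    mask r l j = Nat.ofBits (fun i : Fin (chunkLength j) => keyBit r (160 * l +
      ∑ j' ∈ Finset.univ.filter (· < j), chunkLength j' + (chunkLength j - 1 - i))) := by
  have key : ∀ (n : ℕ) (f : ℕ → Bool), (∑ i ∈ Finset.range n, if f i then 2 ^ (n - 1 - i) else 0)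
      = Nat.ofBits (fun i : Fin n => f (n - 1 - i)) := by
    intro n
    induction n with
    | zero => simp
    | succ n ih =>
      intro f
      rw [Nat.ofBits_succ, Finset.sum_range_succ]
      have h1 : ∀ i ∈ Finset.range n, (if f i = true then 2 ^ (n + 1 - 1 - i) else 0) =
          2 * (if f i = true then 2 ^ (n - 1 - i) else 0) := by
        intro i hi
        have : n + 1 - 1 - i = (n - 1 - i) + 1 := by have := Finset.mem_range.1 hi; omega
        rw [this, pow_succ]; split_ifs <;> ring
      rw [Finset.sum_congr rfl h1, ← Finset.mul_sum, ih]
      have h2 : ∀ i : Fin n, n - (↑i + 1) = n - 1 - (i : ℕ) := fun i => by omega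
      cases h : f n <;> simp [h, h2, Function.comp_def]
  exact key _ (fun i => keyBit r (160 * l +
      ∑ j' ∈ Finset.univ.filter (· < j), chunkLength j' + i))

/-- No key bit of a block is wasted; `i` is the binary weight of bit `u` in its chunk, below 17 as
no chunk is longer. -/
theorem chunks_cover : ∀ u : Fin 160, ∃ j : Fin 10, ∃ i : Fin 17, (i : ℕ) < chunkLength j ∧
    (u : ℕ) = ∑ j' ∈ Finset.univ.filter (· < j), chunkLength j' + (chunkLength j - 1 - i) := by
  decide +kernel

theorem maskParam_injective {L : ℕ} {r r' : Bits (160 * L)}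
    (h : ∀ l < L, maskParam r l = maskParam r' l) : r = r' := by
  have hlt : ∀ (r : Bits (160 * L)) l j, mask r l j < 2 ^ chunkLength j := by
    intro r l j; rw [mask_eq_ofBits]; exact Nat.ofBits_lt_two_pow _
  have hm : ∀ l < L, ∀ j, mask r l j = mask r' l j := by
    intro l hl j
    have := congrFun (h l hl) j
    simp only [maskParam] at this
    rw [ZMod.natCast_eq_natCast_iff'] at this
    rwa [Nat.mod_eq_of_lt (hlt _ _ _), Nat.mod_eq_of_lt (hlt _ _ _)] at this
  funext t
  obtain ⟨j, i, hi, hu⟩ := chunks_cover ⟨t % 160, Nat.mod_lt _ (by norm_num)⟩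
  have h1 := hm (t / 160) (Nat.div_lt_of_lt_mul t.2) j
  rw [mask_eq_ofBits, mask_eq_ofBits] at h1
  have h2 := congrArg (fun a => Nat.testBit a i) h1
  simp only at h2 hu
  rw [Nat.testBit_ofBits_lt _ _ hi, Nat.testBit_ofBits_lt _ _ hi] at h2
  have h3 : 160 * ((t : ℕ) / 160) + ∑ j' ∈ Finset.univ.filter (· < j), chunkLength j' +
      (chunkLength j - 1 - i) = t := by omega
  simpa [h3, keyBit] using h2

/-- Masks lie below their moduli, so residues return all key bits. Both sides have 2^(160 L)
elements, so injectivity suffices. -/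
theorem maskParam_bijective (L : ℕ) : Function.Bijective
    (fun (r : Bits (160 * L)) (l : Fin L) => maskParam r l) := by
  rw [Fintype.bijective_iff_injective_and_card]
  refine ⟨fun r r' h => maskParam_injective fun l hl => congrFun h ⟨l, hl⟩, ?_⟩
  have : ∑ j, chunkLength j = 160 := by decide
  simp [Fintype.card_pi, ZMod.card, Finset.prod_pow_eq_pow_sum, this, pow_mul]

/-- Encryption as a function of the enciphered parameters of all frames. -/
noncomputable def encryptParams (C : Codec) {L : ℕ} (k : Fin L → Param) : Signal (320 * L) :=
  fun t => quantize (∑ l : Fin L,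
    if 320 * (l : ℕ) ≤ (t : ℕ) then trapezoid (t - 320 * l) * paramFrame C (k l) (t - 320 * l)
    else 0)

theorem encrypt_eq (C : Codec) {L : ℕ} (r : Bits (160 * L)) (x : Signal (160 * L)) :
    encrypt C r x = encryptParams C
      ((fun l : Fin L => plainParam C (trackerState C x l) (window x l)) +
        fun l : Fin L => maskParam r l) := by
  funext t
  simp only [encrypt, encryptParams, encFrame_eq, Pi.add_apply]
  rw [Finset.sum_range (f := fun l => if 320 * l ≤ (t : ℕ) then trapezoid (t - 320 * l) *
    paramFrame C (plainParam C (trackerState C x l) (window x l) + maskParam r l) (t - 320 * l)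
    else 0)]

/-- For a uniform key, the distribution of the ciphertext does not depend on the signal. -/
theorem exists_key_equiv (C : Codec) {L : ℕ} (x x' : Signal (160 * L)) :
    ∃ e : Bits (160 * L) ≃ Bits (160 * L), ∀ r, encrypt C (e r) x' = encrypt C r x := by
  let m := Equiv.ofBijective _ (maskParam_bijective L)
  let p (x : Signal (160 * L)) : Fin L → Param :=
    fun l => plainParam C (trackerState C x l) (window x l)
  -- The mask is shifted by the difference of the plaintexts, so that plaintext plus mask is the
  -- same for both signals.
  refine ⟨m.trans ((Equiv.addLeft (p x - p x')).trans m.symm), fun r => ?_⟩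
  have hm : ∀ r x, encrypt C r x = encryptParams C (p x + m r) := fun r x => encrypt_eq C r x
  rw [hm, hm]
  congr 1
  simp only [Equiv.trans_apply, Equiv.apply_symm_apply, Equiv.coe_addLeft]
  abel

/-! ### Encryption frame by frame -/

/-- The `l`-th block of 160 samples, zero outside the duration of the signal. -/
def blockAt {N : ℕ} (x : Signal N) (l : ℕ) : Signal 160 :=
  fun i => if h : 160 * l + (i : ℕ) < N then x ⟨160 * l + i, h⟩ else 0

/-- The block of samples before the `l`-th block. -/
def blockBefore {N : ℕ} (x : Signal N) : ℕ → Signal 160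
  | 0 => fun _ => 0
  | l + 1 => blockAt x l

/-- The `n`-th sample of three consecutive blocks. -/
def tripleSample (a b c : Signal 160) (n : ℕ) : BitVec 16 :=
  if h : n < 160 then a ⟨n, h⟩
  else if h : n - 160 < 160 then b ⟨n - 160, h⟩
  else if h : n - 320 < 160 then c ⟨n - 320, h⟩
  else 0

theorem sampleAt_eq_tripleSample {N : ℕ} (x : Signal N) (l n : ℕ) (hn : n < 480) (t : ℤ)
    (ht : t = 160 * (l : ℤ) - 160 + n) :
    sampleAt x t =
      ((tripleSample (blockBefore x l) (blockAt x l) (blockAt x (l + 1)) n).toInt : ℝ) := by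
  have hb : ∀ (m : ℕ) (i : Fin 160), (t = 160 * m + (i : ℕ)) →
      sampleAt x t = ((blockAt x m i).toInt : ℝ) := by
    intro m i h
    by_cases hN : 160 * m + (i : ℕ) < N
    · have : t.toNat = 160 * m + i := by omega
      rw [sampleAt, dif_pos (by omega), blockAt, dif_pos hN]
      simp [this]
    · rw [sampleAt, dif_neg (by omega), blockAt, dif_neg hN]
      simp
  unfold tripleSample
  split_ifs with h1 h2 h3
  · cases l with
    | zero => rw [sampleAt, dif_neg (by omega)]; simp [blockBefore]
    | succ l => exact hb l ⟨n, h1⟩ (by push_cast at ht; simp only; omega)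
  · exact hb l ⟨n - 160, h2⟩ (by simp only; omega)
  · exact hb (l + 1) ⟨n - 320, h3⟩ (by push_cast; omega)
  · omega

/-- The analysis window of a frame, from the blocks before, at and after the frame. -/
noncomputable def localWindow (a b c : Signal 160) : Fin 320 → ℝ := fun i =>
  ((tripleSample a b c (80 + i)).toInt : ℝ) - 0.85 * ((tripleSample a b c (79 + i)).toInt : ℝ)

/-- The window starts 80 samples before the frame and pre-emphasis looks one sample further back,
that is, at positions 80 and 79 counted from the start of the preceding block. -/
theorem window_eq_localWindow {N : ℕ} (x : Signal N) (l : ℕ) :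
    window x l = localWindow (blockBefore x l) (blockAt x l) (blockAt x (l + 1)) := by
  funext i
  rw [window, emphasized, localWindow,
    sampleAt_eq_tripleSample x l (80 + i) (by omega) _ (by push_cast; ring),
    sampleAt_eq_tripleSample x l (79 + i) (by omega) _ (by push_cast; ring)]

/-- The `l`-th block of 320 samples of the ciphertext, from the parameters of the previous frame
and of the current one. -/
noncomputable def outBlock (C : Codec) (c : Option Param) (k : Param) : Signal 320 := fun i =>
  quantize (c.elim 0 (fun k' => trapezoid (320 + i) * paramFrame C k' (320 + i)) +
    trapezoid i * paramFrame C k i)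

/-- The parameters of the frame before frame `l`. -/
def previous {α : Type} (k : ℕ → α) : ℕ → Option α
  | 0 => none
  | l + 1 => some (k l)

/-- The enciphered parameters of frame `l`. -/
noncomputable def encParam (C : Codec) {L : ℕ} (r : Bits (160 * L)) (x : Signal (160 * L))
    (l : ℕ) : Param :=
  plainParam C (trackerState C x l) (window x l) + maskParam r l

/-- The trapezoid has length 400 and the hop is 320, so only frames `l - 1` and `l` reach the `l`-th
output block. -/
theorem encrypt_block (C : Codec) {L : ℕ} (r : Bits (160 * L)) (x : Signal (160 * L)) (l : ℕ)
    (hl : l < L) (i : Fin 320) (h : 320 * l + (i : ℕ) < 320 * L) :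
    encrypt C r x ⟨320 * l + i, h⟩ =
      outBlock C (previous (encParam C r x) l) (encParam C r x l) i := by
  simp only [encrypt, outBlock, encFrame_eq]
  congr 1
  have hi := i.2
  change (∑ m ∈ Finset.range L, if 320 * m ≤ 320 * l + (i : ℕ) then
    trapezoid (320 * l + i - 320 * m) * paramFrame C (encParam C r x m) (320 * l + i - 320 * m)
    else 0) = _
  have hzero : ∀ m, m ≠ l → m + 1 ≠ l → (if 320 * m ≤ 320 * l + (i : ℕ) then
      trapezoid (320 * l + i - 320 * m) * paramFrame C (encParam C r x m) (320 * l + i - 320 * m)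
      else 0) = 0 := by
    intro m h1 h2
    split_ifs with h3
    · have : trapezoid (320 * l + i - 320 * m) = 0 := by
        rw [trapezoid, if_neg (by omega), if_neg (by omega), if_neg (by omega)]
      rw [this, zero_mul]
    · rfl
  cases l with
  | zero =>
    rw [Finset.sum_eq_single 0 (fun m _ hm => hzero m hm (by omega))
      (fun h => absurd (Finset.mem_range.2 hl) h)]
    simp [previous]
  | succ l =>
    rw [← Finset.sum_subset (s₁ := {l, l + 1}), Finset.sum_pair (by omega)]
    · have e1 : 320 * (l + 1) + (i : ℕ) - 320 * l = 320 + i := by omega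
      have e2 : 320 * (l + 1) + (i : ℕ) - 320 * (l + 1) = i := by omega
      rw [e1, e2, if_pos (by omega), if_pos (by omega)]
      simp [previous]
    · intro m hm
      simp only [Finset.mem_insert, Finset.mem_singleton] at hm
      exact Finset.mem_range.2 (by omega)
    · intro m _ hm
      simp only [Finset.mem_insert, Finset.mem_singleton, not_or] at hm
      exact hzero m hm.2 (by omega)

theorem signalBits_eq_ofFn {N : ℕ} (x : Signal N) :
    signalBits x = List.ofFn (fun t : Fin (N * 16) =>
      (x ⟨t / 16, Nat.div_lt_of_lt_mul (by have := t.2; omega)⟩).getLsbD (t % 16)) := by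
  rw [List.ofFn_mul, signalBits, List.flatMap_def, List.map_ofFn]
  congr 2
  funext i
  simp only [Function.comp_apply]
  congr 1
  funext j
  have h1 : ((i : ℕ) * 16 + j) / 16 = i := by omega
  have h2 : ((i : ℕ) * 16 + j) % 16 = j := by omega
  simp only [h1, h2]

theorem signalBits_length {N : ℕ} (x : Signal N) : (signalBits x).length = N * 16 := by
  rw [signalBits_eq_ofFn, List.length_ofFn]

theorem signalBits_getD {N : ℕ} (x : Signal N) (t : ℕ) :
    (signalBits x).getD t false =
      if h : t / 16 < N then (x ⟨t / 16, h⟩).getLsbD (t % 16) else false := by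
  rw [signalBits_eq_ofFn, List.getD_eq_getElem?_getD, List.getElem?_ofFn]
  by_cases h : t / 16 < N
  · rw [dif_pos h, dif_pos (by omega)]; rfl
  · rw [dif_neg h, dif_neg (by omega)]; rfl

theorem signalBits_injective {N : ℕ} :
    Function.Injective (signalBits : Signal N → List Bool) := by
  intro x y h
  funext t
  refine BitVec.eq_of_getLsbD_eq fun i hi => ?_
  have h1 := congrArg (fun l => l.getD (16 * t + i) false) h
  have h2 : (16 * (t : ℕ) + i) / 16 = t := by omega
  have h3 : (16 * (t : ℕ) + i) % 16 = i := by omega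
  simp only [signalBits_getD, h2, h3, t.2, dite_true] at h1
  exact h1

/-- A block has 160 · 16 = 2560 bits. Missing bits are read as zeros, which agrees with the signal
being zero past its end. -/
theorem padTake_signalBits {N : ℕ} (x : Signal N) (l : ℕ) :
    padTake 2560 ((signalBits x).drop (2560 * l)) = signalBits (blockAt x l) := by
  rw [padTake_eq_ofFn, signalBits_eq_ofFn (blockAt x l)]
  congr 1
  funext t
  have h0 : ∀ k, ((signalBits x).drop k).getD t false =
      (signalBits x).getD (k + t) false := fun k => by
    rw [List.getD_eq_getElem?_getD, List.getD_eq_getElem?_getD, List.getElem?_drop]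
  have h1 : (2560 * l + (t : ℕ)) / 16 = 160 * l + t / 16 := by omega
  have h2 : (2560 * l + (t : ℕ)) % 16 = t % 16 := by omega
  rw [h0, signalBits_getD]
  simp only [h1, h2, blockAt]
  split_ifs <;> simp

theorem signalBits_encrypt (C : Codec) {L : ℕ} (r : Bits (160 * L)) (x : Signal (160 * L)) :
    signalBits (encrypt C r x) = (List.range L).flatMap (fun l =>
      signalBits (outBlock C (previous (encParam C r x) l) (encParam C r x l))) := by
  have h : List.ofFn (encrypt C r x) = (List.range L).flatMap (fun l =>
      List.ofFn (outBlock C (previous (encParam C r x) l) (encParam C r x l))) := by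
    rw [List.ofFn_mul', List.flatMap_def]
    congr 1
    apply List.ext_getElem
    · rw [List.length_ofFn, List.length_map, List.length_range]
    · intro l h1 h2
      simp only [List.getElem_ofFn, List.getElem_map, List.getElem_range]
      congr 1
      funext i
      exact encrypt_block C r x l (by rwa [List.length_ofFn] at h1) i _
  rw [signalBits, h, List.flatMap_assoc]
  rfl

/-- The random parameters of a frame from its 160 key bits. -/
def keyParam (v : List Bool) : Param :=
  maskParam (L := 1) (fun i : Fin (160 * 1) => v.getD i false) 0

theorem keyParam_eq {L : ℕ} (r : Bits (160 * L)) (l : ℕ) (hl : l < L) :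
    keyParam (padTake 160 ((List.ofFn r).drop (160 * l))) = maskParam r l := by
  funext j
  simp only [keyParam, maskParam, mask]
  congr 1
  have hj : ∑ j' ∈ Finset.univ.filter (· < j), chunkLength j' + chunkLength j ≤ 160 := by
    revert j; decide
  refine Finset.sum_congr rfl fun i hi => ?_
  have hi' := Finset.mem_range.1 hi
  have : keyBit (L := 1) (fun i : Fin (160 * 1) =>
      (padTake 160 ((List.ofFn r).drop (160 * l))).getD i false)
      (160 * 0 + ∑ j' ∈ Finset.univ.filter (· < j), chunkLength j' + i) =
      keyBit r (160 * l + ∑ j' ∈ Finset.univ.filter (· < j), chunkLength j' + i) := by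
    generalize ∑ j' ∈ Finset.univ.filter (· < j), chunkLength j' = o at *
    rw [keyBit, keyBit, dif_pos (by omega), dif_pos (by omega), padTake_eq_ofFn]
    have h1 : 160 * 0 + o + i < 160 := by omega
    have h2 : 160 * l + (o + i) < 160 * L := by omega
    rw [List.getD_eq_getElem?_getD, List.getElem?_ofFn, dif_pos h1, Option.getD_some,
      List.getD_eq_getElem?_getD, List.getElem?_drop, List.getElem?_ofFn,
      dif_pos (by simp only; omega), Option.getD_some]
    simp only [mul_zero, zero_add, add_assoc]
  rw [this]

/-! ### The encryption as a finite-state machine -/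

/-- The memory of the encryption between two frames: the previous block, the current block, the
memory of the pitch tracker, and the enciphered parameters of the previous frame. -/
abbrev EncState (C : Codec) : Type :=
  Signal 160 × Signal 160 × Fin (C.trackerSize + 1) × Option Param

/-- The signal with the given bit string. -/
noncomputable def ofSignalBits (N : ℕ) : List Bool → Signal N := Function.invFun signalBits

theorem ofSignalBits_signalBits {N : ℕ} (x : Signal N) : ofSignalBits N (signalBits x) = x :=
  Function.leftInverse_invFun signalBits_injective x

/-- One step of the encryption: from the memory, the bits of the next block of the signal and the
key bits of the frame, the new memory and the bits of a block of the ciphertext. -/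
noncomputable def encStep (C : Codec) (σ : EncState C) (u v : List Bool) :
    EncState C × List Bool :=
  let next := ofSignalBits 160 u
  let w := localWindow σ.1 σ.2.1 next
  let k := plainParam C σ.2.2.1 w + keyParam v
  ((σ.2.1, next, (C.tracker σ.2.2.1 w).1, some k), signalBits (outBlock C σ.2.2.2 k))

/-- The memory of the encryption before frame `l`. -/
noncomputable def encState (C : Codec) {L : ℕ} (r : Bits (160 * L)) (x : Signal (160 * L))
    (l : ℕ) : EncState C :=
  (blockBefore x l, blockAt x l, trackerState C x l, previous (encParam C r x) l)

/-- Because of the look-ahead, step `l` consumes block `l + 1` of the signal but block `l` of the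
key. -/
theorem encStep_encState (C : Codec) {L : ℕ} (r : Bits (160 * L)) (x : Signal (160 * L)) (l : ℕ)
    (hl : l < L) :
    encStep C (encState C r x l) (padTake 2560 ((signalBits x).drop (2560 * (l + 1))))
      (padTake 160 ((List.ofFn r).drop (160 * l))) =
    (encState C r x (l + 1),
      signalBits (outBlock C (previous (encParam C r x) l) (encParam C r x l))) := by
  simp only [encStep, encState, padTake_signalBits, ofSignalBits_signalBits, keyParam_eq r l hl,
    ← window_eq_localWindow]
  rfl

/-! ### Finite-state machines as programs -/

/-- Fixed length allows a state to be read back by `readBits` with a constant number of bits; the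
code used is one-hot. -/
theorem exists_fixed_length_code (S : Type) [Finite S] :
    ∃ (m : ℕ) (enc : S → List Bool) (dec : List Bool → Option S),
      (∀ σ, (enc σ).length = m) ∧ ∀ σ, dec (enc σ) = some σ := by
  obtain ⟨m, ⟨e⟩⟩ := Finite.exists_equiv_fin S
  let enc : S → List Bool := fun σ => List.ofFn (fun i : Fin m => decide (e σ = i))
  have hinj : Function.Injective enc := by
    intro σ τ h
    have := congrFun (List.ofFn_injective h) (e σ)
    simpa [eq_comm] using this
  classical
  refine ⟨m, enc, fun l => if h : ∃ σ, enc σ = l then some h.choose else none, fun σ => by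
    simp [enc], fun σ => ?_⟩
  have h : ∃ τ, enc τ = enc σ := ⟨σ, rfl⟩
  simp only [dif_pos h]
  rw [hinj h.choose_spec]

/-- One step of a finite-state machine with transition function `f`: the state is kept in register
`Q`, `kx` bits are read from register `X` and `kr` bits from `R`; the output goes to `O`. -/
def machineStep (X R Q O m kx kr : ℕ)
    (f : List Bool → List Bool → List Bool → List Bool × List Bool) : Prog :=
  readBits Q m fun a => readBits X kx fun u => readBits R kr fun v =>
    .seq (pushList Q (f a u v).1.reverse) (pushList O (f a u v).2)

theorem machineStep_does {X R Q O m kx kr : ℕ}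
    {f : List Bool → List Bool → List Bool → List Bool × List Bool}
    (hXR : X ≠ R) (hXQ : X ≠ Q) (hXO : X ≠ O) (hRQ : R ≠ Q) (hRO : R ≠ O) (hQO : Q ≠ O)
    (s : Store) (ko : ℕ) {a a' y : List Bool} (ha : s Q = a) (ham : a.length = m)
    (ham' : a'.length = m) (hy : y.length = ko)
    (hf : f a (padTake kx (s X)) (padTake kr (s R)) = (a', y)) :
    (machineStep X R Q O m kx kr f).Does s
      (Function.update (Function.update (Function.update (Function.update s X ((s X).drop kx))
        R ((s R).drop kr)) Q a') O (y.reverse ++ s O)) (3 * m + 2 * kx + 2 * kr + ko + 2) := by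
  refine (readBits_does Q m _ s _ (m + 2 * kx + 2 * kr + ko + 2) ?_).mono (by omega)
  refine (readBits_does X kx _ _ _ (m + 2 * kr + ko + 2) ?_).mono (by omega)
  refine (readBits_does R kr _ _ _ (m + ko + 2) ?_).mono (by omega)
  have e1 : padTake m (s Q) = a := by rw [ha, padTake_of_length ham]
  have e2 : (s Q).drop m = [] := by rw [ha, ← ham]; simp
  simp only [Function.update_of_ne hXQ, Function.update_of_ne hRQ, Function.update_of_ne hXR.symm,
    e1, e2, hf]
  convert (pushList_does Q a'.reverse _).seq (pushList_does O y _) using 1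
  · funext i
    by_cases h1 : i = O
    · subst h1
      simp [Function.update_of_ne hXO.symm, Function.update_of_ne hRO.symm,
        Function.update_of_ne hQO.symm]
    · by_cases h2 : i = Q
      · subst h2
        simp [h1, Function.update_of_ne hXQ.symm, Function.update_of_ne hRQ.symm]
      · by_cases h3 : i = R
        · subst h3; simp [h1, h2]
        · by_cases h4 : i = X
          · subst h4; simp [h1, h2, h3]
          · simp [h1, h2, h3, h4]
  · simp [ham', hy]; omega

/-- The key register drives the loop: with `kr * n` bits it runs dry after exactly `n` rounds, while
`X` may be exhausted earlier. New states are pushed backwards so as to be read forwards; the output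
piles up in reverse. -/
theorem machine_does {X R Q O m kx kr : ℕ}
    {f : List Bool → List Bool → List Bool → List Bool × List Bool}
    (hXR : X ≠ R) (hXQ : X ≠ Q) (hXO : X ≠ O) (hRQ : R ≠ Q) (hRO : R ≠ O) (hQO : Q ≠ O)
    (hkr : 0 < kr) (s : Store) (ko n : ℕ) (σ y : ℕ → List Bool) (hQ : s Q = σ 0)
    (hR : (s R).length = kr * n) (hσ : ∀ l ≤ n, (σ l).length = m) (hy : ∀ l < n, (y l).length = ko)
    (hf : ∀ l < n, f (σ l) (padTake kx ((s X).drop (kx * l)))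
      (padTake kr ((s R).drop (kr * l))) = (σ (l + 1), y l)) :
    ∃ s', (Prog.loop R (machineStep X R Q O m kx kr f)).Does s s'
        ((3 * m + 2 * kx + 2 * kr + ko + 3) * n + 1) ∧
      s' O = ((List.range n).flatMap y).reverse ++ s O ∧
      ∀ i, i ≠ X → i ≠ R → i ≠ Q → i ≠ O → s' i = s i := by
  let S (l : ℕ) : Store := Function.update (Function.update (Function.update (Function.update s
    X ((s X).drop (kx * l))) R ((s R).drop (kr * l))) Q (σ l)) O
      (((List.range l).flatMap y).reverse ++ s O)
  have SX : ∀ l, S l X = (s X).drop (kx * l) := fun l => by simp [S, hXR, hXQ, hXO]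
  have SR : ∀ l, S l R = (s R).drop (kr * l) := fun l => by simp [S, hRQ, hRO]
  have SQ : ∀ l, S l Q = σ l := fun l => by simp [S, hQO]
  have SO : ∀ l, S l O = ((List.range l).flatMap y).reverse ++ s O := fun l => by simp [S]
  have Sr : ∀ l i, i ≠ X → i ≠ R → i ≠ Q → i ≠ O → S l i = s i := fun l i h1 h2 h3 h4 => by
    simp [S, h1, h2, h3, h4]
  have S0 : S 0 = s := by
    funext i
    simp only [S, Function.update_apply]
    split_ifs with h1 h2 h3 h4
    · simp [h1]
    · simp [h2, hQ]
    · simp [h3]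
    · simp [h4]
    · rfl
  refine ⟨S n, ?_, SO n, Sr n⟩
  rw [← S0]
  refine Prog.Does.loop n S (fun l hl => ?_) ?_ (fun l hl => ?_)
  · rw [SR, Ne, List.drop_eq_nil_iff, hR, not_le]
    exact Nat.mul_lt_mul_of_pos_left hl hkr
  · rw [SR, List.drop_eq_nil_iff, hR]
  · convert machineStep_does hXR hXQ hXO hRQ hRO hQO (S l) ko (SQ l) (hσ l hl.le) (hσ (l + 1) hl)
      (hy l hl) (by rw [SX, SR]; exact hf l hl) using 1
    funext i
    by_cases h4 : i = O
    · subst h4; simp [SO, List.range_succ]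
    · by_cases h3 : i = Q
      · subst h3; simp [SQ, h4]
      · by_cases h2 : i = R
        · subst h2; simp [SR, h3, h4, Nat.mul_succ]
        · by_cases h1 : i = X
          · subst h1; simp [SX, h2, h3, h4, Nat.mul_succ]
          · simp [Sr, h1, h2, h3, h4]

/-- The encryption is computed by a program in linear time: from the signal in register `X` and the
key in register `R`, with the empty work register `Q`, it writes the ciphertext in reverse order to
register `O`. -/
theorem exists_encrypt_prog (C : Codec) {X R Q O : ℕ}
    (hXR : X ≠ R) (hXQ : X ≠ Q) (hXO : X ≠ O) (hRQ : R ≠ Q) (hRO : R ≠ O) (hQO : Q ≠ O) :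
    ∃ (p : Prog) (c : ℕ), ∀ (L : ℕ) (r : Bits (160 * L)) (x : Signal (160 * L)) (s : Store),
      s X = signalBits x → s R = List.ofFn r → s Q = [] → s O = [] →
      ∃ s', p.Does s s' (c * (L + 1)) ∧ s' O = (signalBits (encrypt C r x)).reverse ∧
        ∀ i, i ≠ X → i ≠ R → i ≠ Q → i ≠ O → s' i = s i := by
  -- The crux of efficiency: although built from real arithmetic, the memory takes finitely many
  -- values, whatever `L` is.
  have : Finite (EncState C) := inferInstance
  obtain ⟨m, enc, dec, hlen, hdec⟩ := exists_fixed_length_code (EncState C)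
  let f : List Bool → List Bool → List Bool → List Bool × List Bool := fun a u v =>
    (dec a).elim ([], []) (fun σ => (enc (encStep C σ u v).1, (encStep C σ u v).2))
  -- Block 0 is read before the loop, since every round reads one block ahead.
  let ini : List Bool → List Bool := fun u => enc (fun _ => 0, ofSignalBits 160 u, 0, none)
  refine ⟨.seq (readBits X 2560 fun u => pushList Q (ini u).reverse)
    (.loop R (machineStep X R Q O m 2560 160 f)),
    (m + 1 + 2 * 2560) + (3 * m + 2 * 2560 + 2 * 160 + 320 * 16 + 3) + 1,
    fun L r x s hX hR hQ hO => ?_⟩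
  have h0 : padTake 2560 (s X) = signalBits (blockAt x 0) := by
    simpa [hX] using padTake_signalBits x 0
  have h1 := readBits_does X 2560 (fun u => pushList Q (ini u).reverse) s _ (m + 1)
    ((pushList_does Q (ini (padTake 2560 (s X))).reverse _).mono (by simp [ini, hlen]))
  have hini : ini (padTake 2560 (s X)) = enc (encState C r x 0) := by
    simp only [h0, ini, ofSignalBits_signalBits]; rfl
  rw [hini, List.reverse_reverse, Function.update_of_ne hXQ.symm, hQ, List.append_nil] at h1
  set s₁ := Function.update (Function.update s X ((s X).drop 2560)) Q (enc (encState C r x 0))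
    with hs₁
  obtain ⟨s', hd, hO', hr'⟩ := machine_does (kx := 2560) (kr := 160) (m := m) (f := f)
    hXR hXQ hXO hRQ hRO hQO (by norm_num) s₁ (320 * 16) L (fun l => enc (encState C r x l))
    (fun l => signalBits (outBlock C (previous (encParam C r x) l) (encParam C r x l)))
    (by simp [hs₁]) (by simp [hs₁, hRQ, hXR.symm, hR]) (fun l _ => hlen _)
    (fun l _ => signalBits_length _)
    (fun l hl => by
      have e := encStep_encState C r x l hl
      have eX : s₁ X = (signalBits x).drop 2560 := by simp [hs₁, hXQ, hX]
      have eR : s₁ R = List.ofFn r := by simp [hs₁, hRQ, hXR.symm, hR]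
      have e2 : 2560 + 2560 * l = 2560 * (l + 1) := by ring
      simp only [f, hdec, Option.elim_some, eX, eR, List.drop_drop, e2, e])
  refine ⟨s', (h1.seq hd).mono ?_, ?_, fun i h1 h2 h3 h4 => ?_⟩
  · nlinarith
  · rw [hO', signalBits_encrypt]
    simp [hs₁, hXO.symm, hQO.symm, hO]
  · rw [hr' i h1 h2 h3 h4]
    simp [hs₁, h1, h3]

/-! ### Uniform probabilities -/

theorem uniformPr_equiv {Ω Ω' : Type} [Fintype Ω] [Fintype Ω'] (e : Ω ≃ Ω') (E : Ω' → Bool) :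
    uniformPr (fun ω => E (e ω)) = uniformPr E := by
  unfold uniformPr
  rw [Fintype.card_congr e]
  congr 2
  refine Finset.card_bij (fun ω _ => e ω) (by simp) (fun _ _ _ _ h => e.injective h) ?_
  intro ω hω
  exact ⟨e.symm ω, by simpa using hω, by simp⟩

/-- A bijection exchanging an event with its complement forces equal probabilities. -/
theorem uniformPr_eq_half {Ω : Type} [Fintype Ω] [Nonempty Ω] (e : Ω ≃ Ω) (E : Ω → Bool)
    (h : ∀ ω, E (e ω) = !E ω) : uniformPr E = 1 / 2 := by
  have h1 := uniformPr_equiv e E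
  simp only [h] at h1
  have h2 : uniformPr (fun ω => !E ω) + uniformPr E = 1 := by
    unfold uniformPr
    rw [← add_div, div_eq_one_iff_eq (by simp [Fintype.card_ne_zero])]
    have := Finset.card_filter_add_card_filter_not (s := (Finset.univ : Finset Ω))
      (fun ω => E ω = true)
    simp only [Bool.not_eq_true, Finset.card_univ] at this
    simp only [Bool.not_eq_true']
    rw [add_comm]
    exact_mod_cast this
  linarith

/-- The result of the experiment with the key stream `r` in place of the output of the
generator. -/
noncomputable def win (C : Codec) {L : ℕ → ℕ} (A : Adversary L) (n : ℕ) (r : Bits (160 * L n))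
    (b : Bool) (ρ : Bits (A.coins.eval n)) : Bool :=
  A.guess n ρ (encrypt C r (if b then (A.choose n ρ).2 else (A.choose n ρ).1)) == b

/-- Flip the challenge bit and change the key so that the ciphertext stays the same: the guess is
unchanged, so winning and losing are exchanged. The change of key depends on the tape, which
determines the two signals. -/
theorem uniformPr_win (C : Codec) {L : ℕ → ℕ} (A : Adversary L) (n : ℕ) :
    uniformPr (fun ω : Bits (160 * L n) × Bool × Bits (A.coins.eval n) =>
      win C A n ω.1 ω.2.1 ω.2.2) = 1 / 2 := by
  choose e he using fun ρ => exists_key_equiv C (A.choose n ρ).1 (A.choose n ρ).2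
  let φ : Bits (160 * L n) × Bool × Bits (A.coins.eval n) →
      Bits (160 * L n) × Bool × Bits (A.coins.eval n) := fun ω =>
    (if ω.2.1 then (e ω.2.2).symm ω.1 else e ω.2.2 ω.1, !ω.2.1, ω.2.2)
  have hφ : Function.Involutive φ := by
    rintro ⟨r, b, ρ⟩
    cases b <;> simp [φ]
  refine uniformPr_eq_half hφ.toPerm _ ?_
  rintro ⟨r, b, ρ⟩
  cases b
  · simp [φ, win, he]
  · have := he ρ ((e ρ).symm r)
    rw [Equiv.apply_symm_apply] at this
    simp [φ, win, this]

/-! ### The distinguisher of an adversary -/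

theorem pour_frame {x y z : ℕ} (hy : y ≠ x) (hz : z ≠ x) (hyz : y ≠ z) (s : Store)
    {l : List Bool} (hl : s x = l) : ∃ s', (pour x y z).Does s s' (7 * l.length + 1) ∧
      s' x = [] ∧ s' y = l.reverse ++ s y ∧ s' z = l.reverse ++ s z ∧
      ∀ i, i ≠ x → i ≠ y → i ≠ z → s' i = s i := by
  subst hl
  refine ⟨_, pour_does hy hz hyz s, ?_, ?_, ?_, fun i h1 h2 h3 => ?_⟩
  · simp [hy.symm, hz.symm]
  · simp [hyz]
  · simp
  · simp [h1, h2, h3]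

theorem Prog.Outputs.rename {p : Prog} {inputs outputs : List (List Bool)} {T : ℕ}
    (h : p.Outputs inputs outputs T) {f : ℕ → ℕ} (hf : Function.Injective f) {S : Store}
    (hS : ∀ i, S (f i) = load inputs i) :
    ∃ S', (p.rename f).Does S S' T ∧ (∀ i : Fin outputs.length, S' (f i) = outputs.get i) ∧
      ∀ i, i ∉ Set.range f → S' i = S i := by
  obtain ⟨s, t, hr, ht, ho⟩ := h
  obtain ⟨S', hr', hS', hF⟩ := hr.rename hf hS
  exact ⟨S', ⟨t, ht, hr'⟩, fun i => (hS' i).trans (ho i), hF⟩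

/-- Even registers from 10 on belong to the choosing program, odd ones from 11 on to the guessing
program. Below 10, register 3 holds the challenge bit, 4 is for transit, 7 and 8 hold state and
reversed ciphertext, 9 collects rubbish. Pouring twice copies an input in its original order; a
single pour turns the ciphertext around. -/
theorem exists_win_prog (C : Codec) {L : ℕ → ℕ} (A : Adversary L) (B : Polynomial ℕ)
    (hB : ∀ n, L n ≤ B.eval n) :
    ∃ (p : Prog) (T : Polynomial ℕ), ∀ (n : ℕ) (r : Bits (160 * L n)) (b : Bool)
      (ρ : Bits (A.coins.eval n)),
      p.Outputs [unary n, List.ofFn r, b :: List.ofFn ρ] [[win C A n r b ρ]] (T.eval n) := by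
  obtain ⟨pc, Tc, hc⟩ := A.choose_polyTime
  obtain ⟨pg, Tg, hg⟩ := A.guess_polyTime
  obtain ⟨p0, c0, h0⟩ := exists_encrypt_prog C (X := 10) (R := 1) (Q := 7) (O := 8)
    (by decide) (by decide) (by decide) (by decide) (by decide) (by decide)
  obtain ⟨p1, c1, h1⟩ := exists_encrypt_prog C (X := 12) (R := 1) (Q := 7) (O := 8)
    (by decide) (by decide) (by decide) (by decide) (by decide) (by decide)
  let f : ℕ → ℕ := fun i => 2 * i + 10
  let g : ℕ → ℕ := fun i => 2 * i + 11
  have hf : Function.Injective f := fun i j h => by simp only [f] at h; omega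
  have hgi : Function.Injective g := fun i j h => by simp only [g] at h; omega
  refine ⟨.seq (readBits 2 1 fun l => pushList 3 l) <| .seq (pour 0 4 9) <| .seq (pour 4 10 11) <|
    .seq (pour 2 4 9) <| .seq (pour 4 12 13) <| .seq (pc.rename f) <| .seq (.cond 3 .skip p0 p1) <|
    .seq (pour 8 15 9) <| .seq (pg.rename g) <|
    readBits 3 1 fun l => readBits 11 1 fun m => pushList 0 [m == l],
    18 + 14 * Polynomial.X + 14 * A.coins + Tc + Tg +
      (Polynomial.C (c0 + c1) * (B + 1) + Polynomial.C (7 * 320 * 16) * B), fun n r b ρ => ?_⟩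
  set s := load [unary n, List.ofFn r, b :: List.ofFn ρ] with hs
  have i0 : s 0 = unary n := rfl
  have i1 : s 1 = List.ofFn r := rfl
  have i2 : s 2 = b :: List.ofFn ρ := rfl
  have i3 : ∀ i, 3 ≤ i → s i = [] := fun i hi => by
    rw [hs, load, List.getD_eq_default]; simpa using hi
  -- the challenge bit
  have d1 := readBits_does 2 1 (fun l => pushList 3 l) s _ 2
    ((pushList_does 3 _ _).mono (by simp [padTake]))
  obtain ⟨s1, hs1⟩ : ∃ s1, s1 = Function.update (Function.update s 2 (List.ofFn ρ)) 3 [b] :=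
    ⟨_, rfl⟩
  have d1 : (readBits 2 1 fun l => pushList 3 l).Does s s1 4 := by
    convert d1 using 1
    simp [hs1, i2, i3, padTake]
  have F1 : ∀ i, i ≠ 2 → i ≠ 3 → s1 i = s i := fun i h2 h3 => by simp [hs1, h2, h3]
  have a1 : s1 2 = List.ofFn ρ := by simp [hs1]
  have b1 : s1 3 = [b] := by simp [hs1]
  -- copies of the inputs of the adversary
  obtain ⟨s2, d2, x2, y2, -, F2⟩ := pour_frame (x := 0) (y := 4) (z := 9) (by decide) (by decide)
    (by decide) s1 (l := unary n) (by rw [F1 0 (by decide) (by decide), i0])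
  rw [F1 4 (by decide) (by decide), i3 4 (by decide), List.append_nil] at y2
  obtain ⟨s3, d3, x3, y3, z3, F3⟩ := pour_frame (x := 4) (y := 10) (z := 11) (by decide) (by decide)
    (by decide) s2 y2
  obtain ⟨s4, d4, x4, y4, -, F4⟩ := pour_frame (x := 2) (y := 4) (z := 9) (by decide) (by decide)
    (by decide) s3 (l := List.ofFn ρ) (by
      rw [F3 2 (by decide) (by decide) (by decide), F2 2 (by decide) (by decide) (by decide), a1])
  rw [x3, List.append_nil] at y4
  obtain ⟨s5, d5, x5, y5, z5, F5⟩ := pour_frame (x := 4) (y := 12) (z := 13) (by decide) (by decide)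
    (by decide) s4 y4
  have F : ∀ i, i ≠ 0 → i ≠ 2 → i ≠ 3 → i ≠ 4 → i ≠ 9 → i ≠ 10 → i ≠ 11 → i ≠ 12 → i ≠ 13 →
      s5 i = s i := fun i h0 h2 h3 h4 h9 h10 h11 h12 h13 => by
    rw [F5 i h4 h12 h13, F4 i h2 h4 h9, F3 i h4 h10 h11, F2 i h0 h4 h9, F1 i h2 h3]
  have e0 : s5 0 = [] := by
    rw [F5 0 (by decide) (by decide) (by decide), F4 0 (by decide) (by decide) (by decide),
      F3 0 (by decide) (by decide) (by decide), x2]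
  have e3 : s5 3 = [b] := by
    rw [F5 3 (by decide) (by decide) (by decide), F4 3 (by decide) (by decide) (by decide),
      F3 3 (by decide) (by decide) (by decide), F2 3 (by decide) (by decide) (by decide), b1]
  have e10 : s5 10 = unary n := by
    rw [F5 10 (by decide) (by decide) (by decide), F4 10 (by decide) (by decide) (by decide), y3,
      F2 10 (by decide) (by decide) (by decide), F1 10 (by decide) (by decide), i3 10 (by decide)]
    simp
  have e11 : s5 11 = unary n := by
    rw [F5 11 (by decide) (by decide) (by decide), F4 11 (by decide) (by decide) (by decide), z3,
      F2 11 (by decide) (by decide) (by decide), F1 11 (by decide) (by decide), i3 11 (by decide)]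
    simp
  have e12 : s5 12 = List.ofFn ρ := by
    rw [y5, F4 12 (by decide) (by decide) (by decide), F3 12 (by decide) (by decide) (by decide),
      F2 12 (by decide) (by decide) (by decide), F1 12 (by decide) (by decide), i3 12 (by decide)]
    simp
  have e13 : s5 13 = List.ofFn ρ := by
    rw [z5, F4 13 (by decide) (by decide) (by decide), F3 13 (by decide) (by decide) (by decide),
      F2 13 (by decide) (by decide) (by decide), F1 13 (by decide) (by decide), i3 13 (by decide)]
    simp
  have eF : ∀ i, 14 ≤ i → s5 i = [] := fun i hi => by
    rw [F i (by omega) (by omega) (by omega) (by omega) (by omega) (by omega) (by omega)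
      (by omega) (by omega), i3 i (by omega)]
  -- choice of the signals
  obtain ⟨s6, d6, o6, F6⟩ := (hc n ρ).rename hf (S := s5) (by
    rintro (_ | _ | i)
    · exact e10
    · exact e12
    -- The subroutine expects all registers beyond its inputs to be empty.
    · rw [eF _ (by simp only [f]; omega), load, List.getD_eq_default]; simp)
  have G6 : ∀ i, i < 10 ∨ i % 2 = 1 → s6 i = s5 i := fun i hi => F6 i (by
    rintro ⟨j, rfl⟩; simp only [f] at hi; omega)
  have o0 : s6 10 = signalBits (A.choose n ρ).1 := o6 0
  have o1 : s6 12 = signalBits (A.choose n ρ).2 := o6 1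
  have m1 : s6 1 = List.ofFn r := by
    rw [G6 1 (by decide), F 1 (by decide) (by decide) (by decide) (by decide) (by decide)
      (by decide) (by decide) (by decide) (by decide), i1]
  have m3 : s6 3 = [b] := by rw [G6 3 (by decide), e3]
  have m7 : s6 7 = [] := by
    rw [G6 7 (by decide), F 7 (by decide) (by decide) (by decide) (by decide) (by decide)
      (by decide) (by decide) (by decide) (by decide), i3 7 (by decide)]
  have m8 : s6 8 = [] := by
    rw [G6 8 (by decide), F 8 (by decide) (by decide) (by decide) (by decide) (by decide)
      (by decide) (by decide) (by decide) (by decide), i3 8 (by decide)]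
  -- encryption
  obtain ⟨y, hy⟩ : ∃ y, y = encrypt C r (if b then (A.choose n ρ).2 else (A.choose n ρ).1) :=
    ⟨_, rfl⟩
  obtain ⟨s7, d7, o7, F7⟩ : ∃ s7, (Prog.cond 3 .skip p0 p1).Does s6 s7
      ((c0 + c1) * (L n + 1) + 1) ∧ s7 8 = (signalBits y).reverse ∧
      ∀ i, i ≠ 10 → i ≠ 12 → i ≠ 1 → i ≠ 7 → i ≠ 8 → s7 i = s6 i := by
    cases b
    · obtain ⟨s7, d7, o7, F7⟩ := h0 (L n) r (A.choose n ρ).1 s6 o0 m1 m7 m8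
      refine ⟨s7, Prog.Does.condCons m3 (d7.mono ?_), by rw [hy]; exact o7,
        fun i h10 _ => F7 i h10⟩
      gcongr; omega
    · obtain ⟨s7, d7, o7, F7⟩ := h1 (L n) r (A.choose n ρ).2 s6 o1 m1 m7 m8
      refine ⟨s7, Prog.Does.condCons m3 (d7.mono ?_), by rw [hy]; exact o7,
        fun i _ h12 => F7 i h12⟩
      gcongr; omega
  have G7 : ∀ i, i = 0 ∨ i = 3 ∨ 11 ≤ i ∧ i % 2 = 1 → s7 i = s5 i := fun i hi => by
    rw [F7 i (by omega) (by omega) (by omega) (by omega) (by omega), G6 i (by omega)]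
  obtain ⟨s8, d8, x8, y8, -, F8⟩ := pour_frame (x := 8) (y := 15) (z := 9) (by decide) (by decide)
    (by decide) s7 o7
  have G8 : ∀ i, i ≠ 15 → i = 0 ∨ i = 3 ∨ 11 ≤ i ∧ i % 2 = 1 → s8 i = s5 i := fun i h15 hi => by
    rw [F8 i (by omega) (by omega) (by omega), G7 i hi]
  rw [G7 15 (by decide), eF 15 (by decide), List.reverse_reverse, List.append_nil] at y8
  -- the guess
  obtain ⟨s9, d9, o9, F9⟩ := (hg n ρ y).rename hgi (S := s8) (by
    rintro (_ | _ | _ | i)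
    · exact (G8 11 (by decide) (by decide)).trans e11
    · exact (G8 13 (by decide) (by decide)).trans e13
    · exact y8
    · rw [G8 _ (by simp only [g]; omega) (by simp only [g]; omega),
        eF _ (by simp only [g]; omega), load, List.getD_eq_default]
      simp)
  have n11 : s9 11 = [A.guess n ρ y] := o9 0
  have G9 : ∀ i, i < 10 → s9 i = s8 i := fun i hi => F9 i (by
    rintro ⟨j, rfl⟩; simp only [g] at hi; omega)
  have n3 : s9 3 = [b] := by rw [G9 3 (by decide), G8 3 (by decide) (by decide), e3]
  have n0 : s9 0 = [] := by rw [G9 0 (by decide), G8 0 (by decide) (by decide), e0]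
  -- comparison
  obtain ⟨s10, d10, o10⟩ : ∃ s10, (readBits 3 1 fun l => readBits 11 1 fun m =>
      pushList 0 [m == l]).Does s9 s10 6 ∧ s10 0 = [win C A n r b ρ] := by
    refine ⟨_, readBits_does 3 1 _ s9 _ 4 (readBits_does 11 1 _ _ _ 2
      (pushList_does 0 _ _)), ?_⟩
    have : (A.guess n ρ y == b) = win C A n r b ρ := by rw [hy]; rfl
    rw [← this]
    simp [n0, n3, n11, padTake]
  obtain ⟨t, ht, hr⟩ := d1.seq (d2.seq (d3.seq (d4.seq (d5.seq (d6.seq (d7.seq (d8.seq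
    (d9.seq d10))))))))
  refine ⟨s10, t, hr, ht.trans ?_, fun i => ?_⟩
  · simp only [List.length_reverse, unary, List.length_replicate, List.length_ofFn,
      signalBits_length, Polynomial.eval_add, Polynomial.eval_mul, Polynomial.eval_C,
      Polynomial.eval_X, Polynomial.eval_one, Polynomial.eval_ofNat]
    have hL := hB n
    have : (c0 + c1) * (L n + 1) ≤ (c0 + c1) * (B.eval n + 1) := by gcongr
    omega
  · fin_cases i; exact o10

/-- The first bit of a tape and the remaining tape. -/
def splitTape {m k : ℕ} (h : m = k + 1) : Bits m ≃ Bool × Bits k :=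
  ((finCongr h).arrowCongr (Equiv.refl Bool)).trans (Fin.consEquiv (fun _ => Bool)).symm

theorem ofFn_eq_splitTape {m k : ℕ} (h : m = k + 1) (ρ : Bits m) :
    List.ofFn ρ = (splitTape h ρ).1 :: List.ofFn (splitTape h ρ).2 := by
  subst h
  rw [List.ofFn_succ]
  rfl

/-- Time bounds are polynomials over ℕ, so the coefficients of `P` are replaced by their absolute
values, rounded up. -/
theorem exists_natPolynomial_bound {L : ℕ → ℕ} {P : Polynomial ℝ}
    (h : ∀ n : ℕ, (L n : ℝ) = P.eval (n : ℝ)) : ∃ B : Polynomial ℕ, ∀ n, L n ≤ B.eval n := by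
  refine ⟨∑ i ∈ Finset.range (P.natDegree + 1), Polynomial.C ⌈|P.coeff i|⌉₊ * Polynomial.X ^ i,
    fun n => ?_⟩
  have : (L n : ℝ) ≤ ((∑ i ∈ Finset.range (P.natDegree + 1), ⌈|P.coeff i|⌉₊ * n ^ i : ℕ) : ℝ) := by
    rw [h, Polynomial.eval_eq_sum_range]
    push_cast
    gcongr with i
    exact (le_abs_self _).trans (Nat.le_ceil _)
  simpa [Polynomial.eval_finsetSum] using Nat.cast_le.1 this

/-- The distinguisher's tape has one more bit than the adversary's, the challenge bit. On a uniform
string it accepts with probability exactly 1/2, hence the equality. -/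
theorem exists_distinguisher (C : Codec) {L : ℕ → ℕ} (A : Adversary L) {P : Polynomial ℝ}
    (h : ∀ n : ℕ, (L n : ℝ) = P.eval (n : ℝ)) :
    ∃ D : Distinguisher L, ∀ (G : (n : ℕ) → Bits n → Bits (160 * L n)) (n : ℕ),
      |privKEavPr C G A n - 1 / 2| = prgAdvantage G D n := by
  obtain ⟨B, hB⟩ := exists_natPolynomial_bound h
  obtain ⟨p, T, hp⟩ := exists_win_prog C A B hB
  have hc : ∀ n, (A.coins + 1).eval n = A.coins.eval n + 1 := fun n => by simp
  refine ⟨⟨A.coins + 1, fun n r ρ => win C A n r (splitTape (hc n) ρ).1 (splitTape (hc n) ρ).2,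
    p, T, fun n r ρ => ?_⟩, fun G n => ?_⟩
  · rw [ofFn_eq_splitTape (hc n) ρ]
    exact hp n r _ _
  · rw [prgAdvantage, ← uniformPr_win C A n, privKEavPr]
    congr 2
    · exact (uniformPr_equiv ((Equiv.refl (Bits n)).prodCongr (splitTape (hc n)))
        (fun ω : Bits n × Bool × Bits (A.coins.eval n) => win C A n (G n ω.1) ω.2.1 ω.2.2)).symm
    · exact (uniformPr_equiv ((Equiv.refl (Bits (160 * L n))).prodCongr (splitTape (hc n)))
        (fun ω : Bits (160 * L n) × Bool × Bits (A.coins.eval n) =>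
          win C A n ω.1 ω.2.1 ω.2.2)).symm

/-! ### Countably many adversaries -/

theorem Prog.Outputs.det {p : Prog} {inputs o₁ o₂ : List (List Bool)} {T₁ T₂ : ℕ}
    (h₁ : p.Outputs inputs o₁ T₁) (h₂ : p.Outputs inputs o₂ T₂) (i : ℕ) (hi₁ : i < o₁.length)
    (hi₂ : i < o₂.length) : o₁[i] = o₂[i] := by
  obtain ⟨s₁, t₁, r₁, -, e₁⟩ := h₁
  obtain ⟨s₂, t₂, r₂, -, e₂⟩ := h₂
  cases r₁.det r₂
  exact (e₁ ⟨i, hi₁⟩).symm.trans (e₂ ⟨i, hi₂⟩)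

/-- Programs determine the functions of an adversary, because runs are deterministic and
`signalBits` is injective; all other fields are propositions. -/
instance (L : ℕ → ℕ) : Countable (Adversary L) := by
  have : Countable (Polynomial ℕ) := by
    rw [← Cardinal.mk_le_aleph0_iff]
    exact Polynomial.cardinalMk_le_max.trans (by simp)
  refine Function.Injective.countable
    (f := fun A : Adversary L => (A.coins, A.choose_polyTime.choose, A.guess_polyTime.choose)) ?_
  intro A A' h
  simp only [Prod.mk.injEq] at h
  obtain ⟨hq, hc, hg⟩ := h
  have c := A.choose_polyTime.choose_spec
  have g := A.guess_polyTime.choose_spec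
  have c' := A'.choose_polyTime.choose_spec
  have g' := A'.guess_polyTime.choose_spec
  rw [← hc] at c'
  rw [← hg] at g'
  generalize A.choose_polyTime.choose = pc at c c'
  generalize A.guess_polyTime.choose = pg at g g'
  clear hc hg
  obtain ⟨q, ch, gu, ne, pt, pt'⟩ := A
  obtain ⟨q', ch', gu', ne', pu, pu'⟩ := A'
  obtain rfl : q = q' := hq
  obtain ⟨T, c⟩ := c
  obtain ⟨T', c'⟩ := c'
  obtain ⟨U, g⟩ := g
  obtain ⟨U', g'⟩ := g'
  have e1 : ch = ch' := by
    funext n ρ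
    exact Prod.ext (signalBits_injective ((c n ρ).det (c' n ρ) 0 (by simp) (by simp)))
      (signalBits_injective ((c n ρ).det (c' n ρ) 1 (by simp) (by simp)))
  have e2 : gu = gu' := by
    funext n ρ y
    exact List.head_eq_of_cons_eq ((g n ρ y).det (g' n ρ y) 0 (by simp) (by simp))
  subst e1 e2
  rfl

theorem Negligible.eventually_le {f : ℕ → ℝ} (hf : Negligible f) (k : ℕ) :
    ∃ N : ℕ, ∀ n, N ≤ n → f n ≤ 1 / ((n : ℝ) + 1) ^ k := by
  obtain ⟨N, hN⟩ := hf.2 ((Polynomial.X + 1) ^ k) (fun n => by simp; positivity)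
  exact ⟨N + 1, fun n hn => by simpa using (hN n (by omega)).le⟩

theorem negligible_of_eventually_le {f : ℕ → ℝ} (h0 : ∀ n, 0 ≤ f n)
    (h : ∀ k : ℕ, ∃ N : ℕ, ∀ n, N ≤ n → f n ≤ 1 / ((n : ℝ) + 1) ^ k) : Negligible f := by
  refine ⟨h0, fun p hp => ?_⟩
  set c := ∑ i ∈ Finset.range (p.natDegree + 1), |p.coeff i| with hc
  -- One power more than the degree, to absorb the constant `c` once `n + 1 > c`.
  obtain ⟨N, hN⟩ := h (p.natDegree + 1)
  refine ⟨max N ⌈c⌉₊, fun n hn => (hN n (by omega)).trans_lt ?_⟩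
  refine one_div_lt_one_div_of_lt (hp n) ?_
  have h1 : p.eval (n : ℝ) ≤ c * ((n : ℝ) + 1) ^ p.natDegree := by
    rw [Polynomial.eval_eq_sum_range, hc, Finset.sum_mul]
    refine Finset.sum_le_sum fun i hi => ?_
    have hi' : i ≤ p.natDegree := by have := Finset.mem_range.1 hi; omega
    calc p.coeff i * (n : ℝ) ^ i ≤ |p.coeff i| * ((n : ℝ) + 1) ^ i := by
          gcongr
          · exact le_abs_self _
          · linarith
      _ ≤ |p.coeff i| * ((n : ℝ) + 1) ^ p.natDegree := by
          gcongr
          linarith [(Nat.cast_nonneg n : (0 : ℝ) ≤ n)]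
  have h2 : c < (n : ℝ) + 1 := by
    have h3 : (⌈c⌉₊ : ℝ) ≤ n := by exact_mod_cast (by omega : ⌈c⌉₊ ≤ n)
    linarith [Nat.le_ceil c]
  rw [pow_succ']
  exact h1.trans_lt (by gcongr)

/-- Countably many negligible functions are eventually below a common negligible function. -/
theorem exists_negligible_bound {f : ℕ → ℕ → ℝ} (hf : ∀ i, Negligible (f i)) :
    ∃ g : ℕ → ℝ, Negligible g ∧ ∀ i, ∃ N : ℕ, ∀ n, N < n → f i n ≤ g n := by
  choose N hN using fun i k => (hf i).eventually_le k
  -- From `M k` on, each of the functions `f 0, …, f k` is below the `k`-th inverse power; a sum of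
  -- thresholds serves as their maximum.
  let M (k : ℕ) : ℕ := ∑ i ∈ Finset.range (k + 1), N i k
  have hM : ∀ k i n, i ≤ k → M k ≤ n → f i n ≤ 1 / ((n : ℝ) + 1) ^ k := fun k i n hi hn =>
    hN i k n ((Finset.single_le_sum (f := fun i => N i k) (fun _ _ => Nat.zero_le _)
      (Finset.mem_range.2 (by omega))).trans hn)
  -- The largest exponent `k ≤ n` whose threshold has been passed, and 0 if there is none. It tends
  -- to infinity, so the bound with exponent `K n` is negligible.
  let K (n : ℕ) : ℕ := Nat.findGreatest (fun k => k = 0 ∨ M k ≤ n) n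
  have hK : ∀ k n, k ≤ n → M k ≤ n → k ≤ K n := fun k n h1 h2 =>
    Nat.le_findGreatest h1 (Or.inr h2)
  have hK' : ∀ n, 1 ≤ K n → M (K n) ≤ n := fun n hn => by
    rcases Nat.findGreatest_spec (P := fun k => k = 0 ∨ M k ≤ n) (Nat.zero_le n)
      (Or.inl rfl) with h | h
    · exact absurd h (Nat.one_le_iff_ne_zero.1 hn)
    · exact h
  refine ⟨fun n => 1 / ((n : ℝ) + 1) ^ K n, negligible_of_eventually_le (fun n => by positivity)
    fun k => ⟨max k (M k), fun n hn => ?_⟩, fun i => ⟨max (i + 1) (M (i + 1)), fun n hn => ?_⟩⟩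
  · refine one_div_le_one_div_of_le (by positivity) ?_
    exact pow_le_pow_right₀ (by linarith [(Nat.cast_nonneg n : (0 : ℝ) ≤ n)])
      (hK k n (by omega) (by omega))
  -- With `i + 1` in place of `i`, `K n` is positive even for `i = 0`, so its threshold has really
  -- been passed.
  · have h1 := hK (i + 1) n (by omega) (by omega)
    exact hM (K n) i n (by omega) (hK' n (by omega))

end SpeechEnc

theorem proposition1
    (C : SpeechEnc.Codec)
    (L : ℕ → ℕ) (P : Polynomial ℝ) (hLP : ∀ n : ℕ, (L n : ℝ) = P.eval (n : ℝ))
    (hL : ∀ n : ℕ, n < L n)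
    (G : (n : ℕ) → SpeechEnc.Bits n → SpeechEnc.Bits (160 * L n))
    (hG : SpeechEnc.IsSecurePRG G) :
    (∀ A : SpeechEnc.Adversary L, ∃ negl : ℕ → ℝ, SpeechEnc.Negligible negl ∧
      ∀ n : ℕ, |SpeechEnc.privKEavPr C G A n - 1 / 2| ≤ negl n) ∧
    (∃ negl : ℕ → ℝ, SpeechEnc.Negligible negl ∧
      ∀ A : SpeechEnc.Adversary L, ∃ N : ℕ, ∀ n : ℕ, N < n →
        |SpeechEnc.privKEavPr C G A n - 1 / 2| ≤ negl n) := by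
  have key : ∀ A : SpeechEnc.Adversary L,
      SpeechEnc.Negligible (fun n => |SpeechEnc.privKEavPr C G A n - 1 / 2|) := by
    intro A
    obtain ⟨D, hD⟩ := SpeechEnc.exists_distinguisher C A hLP
    rw [funext (hD G)]
    exact hG.2 D
  refine ⟨fun A => ⟨_, key A, fun n => le_rfl⟩, ?_⟩
  -- Enumerating the adversaries by ℕ requires at least one of them.
  rcases isEmpty_or_nonempty (SpeechEnc.Adversary L) with hA | hA
  · exact ⟨fun _ => 0, SpeechEnc.negligible_of_eventually_le (fun _ => le_rfl)
      (fun k => ⟨0, fun n _ => by positivity⟩), fun A => hA.elim A⟩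
  · obtain ⟨a, ha⟩ := exists_surjective_nat (SpeechEnc.Adversary L)
    obtain ⟨g, hg, hfg⟩ := SpeechEnc.exists_negligible_bound (fun i => key (a i))
    refine ⟨g, hg, fun A => ?_⟩
    obtain ⟨i, rfl⟩ := ha A
    exact hfg i
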